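/- Let $L$ be an alternating oriented link (a link having a diagram in which over- and under-crossings alternate along every component), and let $\Delta_L(t)\in\mathbb Z[t^{\pm1}]$ be its Alexander polynomial, which is defined up to units $\pm t^k$. Let $P(t)\in\mathbb Z[t]$ be any polynomial with $P\doteq\Delta_L$ up to such a unit, with the sign chosen so that the leading coefficient of $P(-t)$ is nonnegative (so it is positive unless $P=0$). Write $P(-t)=\sum_{k=0}^{d}c_k t^k$ with $d=\deg P$ ($d=0$ if $P=0$), and let $$\mathrm{Homog}(P(-t))=\sum_{k=0}^d c_k\,t^kz^{d-k},\qquad \mathcal N\bigl(\mathrm{Homog}(P(-t))\bigr)=\sum_{k=0}^d \frac{c_k}{k!\,(d-k)!}\,t^kz^{d-k}.$$ Then $\mathrm{Homog}(P(-t))$ is denormalized Lorentzian, that is, $\mathcal N(\mathrm{Homog}(P(-t)))$ is Lorentzian, if and only if the absolute values $(|a_i|)_{i\in\mathbb Z}$ of the coefficients of $\Delta_L(t)=\sum_i a_it^i$ form a log-concave sequence ($|a_{i-1}||a_{i+1}|\le |a_i|^2$ for all $i$) with no internal zeros (if $i<j<k$ and $a_i,a_k\ne0$, then $a_j\neq 0$).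 Here a homogeneous polynomial of degree $d$ in $m$ variables with nonnegative real coefficients is strictly Lorentzian if for every $\alpha\in\mathbb N^m$ with $|\alpha|=d-2$ the polynomial $\partial^\alpha$ of it is a nondegenerate quadratic form of signature $(1,m-1)$, and a homogeneous polynomial is Lorentzian if it is a limit of strictly Lorentzian polynomials of the same degree in the same variables. -/

import Mathlib

open scoped Polynomial LaurentPolynomial Topology

noncomputable section

/-! ### Oriented link diagrams -/

/-- The combinatorial data of an oriented link diagram (a signed Gauss code). Every crossing is
passed twice, once by its over-strand, the passage `(x, true)`, and once by its under-strand, the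
passage `(x, false)`. `next p` is the passage met immediately after `p` when travelling along the
link in the direction of its orientation, and `numCircles` is the number of components without
crossings. A crossing has sign `1` if the direction of the under-strand is obtained by turning
the direction of the over-strand counterclockwise (by less than a half turn), and `-1` otherwise.
The edges of the diagram are indexed by passages: edge `p` leads from `p` to `next p`. -/
structure GaussDiagram where
  numCrossings : ℕ
  sign : Fin numCrossings → ℤˣ
  next : Equiv.Perm (Fin numCrossings × Bool)
  numCircles : ℕ

namespace GaussDiagram

abbrev Passage (D : GaussDiagram) : Type := Fin D.numCrossings × Bool

/-- Number of components of the link: cycles of passages, and components without crossings. -/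
def numComponents (D : GaussDiagram) : ℕ :=
  D.numCircles + Nat.card (Quot fun p q : D.Passage => D.next p = q)

/-- Number of connected components of the underlying 4-valent graph (without the circles). -/
def numPieces (D : GaussDiagram) : ℕ :=
  Nat.card (Quot fun x y : Fin D.numCrossings => ∃ b b' : Bool, D.next (x, b) = (y, b'))

/-- Walking along a face with the face on the left. The pair `(p, true)` is the edge `p` traversed
forwards, `(p, false)` is the edge `p` traversed backwards. On arriving at a crossing along one
strand one turns left into the other strand; whether this is in the direction of its orientation
is decided by the sign of the crossing. -/
def leftTurn (D : GaussDiagram) (d : D.Passage × Bool) : D.Passage × Bool :=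
  let q : D.Passage := if d.2 then D.next d.1 else d.1
  let s : ℤˣ := D.sign q.1 * (if q.2 then 1 else -1) * (if d.2 then 1 else -1)
  if s = 1 then ((q.1, !q.2), true) else (D.next.symm (q.1, !q.2), false)

/-- Number of faces, where every connected piece is drawn on a closed surface of its own. -/
def numFaces (D : GaussDiagram) : ℕ :=
  Nat.card (Quot fun d e : D.Passage × Bool => D.leftTurn d = e)

/-- The Gauss code can be drawn on the sphere: every connected piece has Euler characteristic `2`,
that is, `V - E + F = 2 * (number of pieces)` with `E = 2 * V`. -/
def IsPlanar (D : GaussDiagram) : Prop :=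
  D.numFaces = D.numCrossings + 2 * D.numPieces

/-- Over- and underpasses alternate along every component. -/
def IsAlternating (D : GaussDiagram) : Prop :=
  ∀ p : D.Passage, (D.next p).2 = !p.2

/-- `D'` arises from `D` by forgetting the crossings in `S` (and renaming the others): the next
passage in `D'` is the next passage in `D` at a crossing outside `S`, and the components all of
whose crossings have been forgotten survive as components without crossings. -/
def Forgets (D D' : GaussDiagram) (S : Set (Fin D.numCrossings)) : Prop :=
  ∃ φ : Fin D'.numCrossings ↪ Fin D.numCrossings,
    Set.range φ = Sᶜ ∧
    (∀ x, D'.sign x = D.sign (φ x)) ∧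
    (∀ p : D'.Passage, ∃ k : ℕ,
      (∀ j, 1 ≤ j → j ≤ k → ((D.next ^ j) (φ p.1, p.2)).1 ∈ S) ∧
      (D.next ^ (k + 1)) (φ p.1, p.2) = (φ (D'.next p).1, (D'.next p).2)) ∧
    D'.numComponents = D.numComponents

/-- The passages `p`, `q` are consecutive: `p` just before `q` if `a = 1`, and `q` just before `p`
if `a = -1`. -/
def Consecutive (D : GaussDiagram) (a : ℤˣ) (p q : D.Passage) : Prop :=
  (a = 1 ∧ D.next p = q) ∨ (a = -1 ∧ D.next q = p)

/-- Crossings `x` (top strand over middle strand), `y` (top over bottom) and `z` (middle over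
bottom) that are the corners of a triangular face. The sign condition says that the three edges
bound a face. -/
def IsTriangle (D : GaussDiagram) (x y z : Fin D.numCrossings) : Prop :=
  x ≠ y ∧ x ≠ z ∧ y ≠ z ∧ ∃ a b c : ℤˣ,
    D.Consecutive a (x, true) (y, true) ∧
    D.Consecutive b (x, false) (z, true) ∧
    D.Consecutive c (y, false) (z, false) ∧
    D.sign x * (a * b) = D.sign y * (a * c) ∧ D.sign y * (a * c) = D.sign z * (b * c)

/-- Moving a strand across the triangle `x`, `y`, `z`: on each of the three strands the two
consecutive passages are interchanged. -/
def slide (D : GaussDiagram) (x y z : Fin D.numCrossings) : GaussDiagram :=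
  let τ : Equiv.Perm D.Passage :=
    Equiv.swap (x, true) (y, true) * Equiv.swap (x, false) (z, true) *
      Equiv.swap (y, false) (z, false)
  { D with next := τ * D.next * τ⁻¹ }

/-! ### The Alexander polynomial of a diagram -/

/-- Generators of the Alexander module: the edges and the circles without crossings. -/
abbrev Gen (D : GaussDiagram) : Type := D.Passage ⊕ Fin D.numCircles

/-- The row vector of the edge leaving the passage `p`. -/
def outEdge (D : GaussDiagram) (p : D.Passage) : D.Gen → ℤ[T;T⁻¹] := Pi.single (Sum.inl p) 1

/-- The row vector of the edge arriving at the passage `p`. -/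
def inEdge (D : GaussDiagram) (p : D.Passage) : D.Gen → ℤ[T;T⁻¹] := D.outEdge (D.next.symm p)

/-- The Alexander matrix, the matrix of abelianized Fox derivatives of the Wirtinger relations.
An over-passage does not change the generator. At an under-passage the relation is
`(1 - t) a + t r - l`, with `a` the over-strand and `r`, `l` the parts of the under-strand on the
right and on the left of the over-strand; at a positive crossing the under-strand runs from right
to left, and at a negative crossing from left to right. -/
def alexanderMatrix (D : GaussDiagram) : Matrix D.Passage D.Gen ℤ[T;T⁻¹] :=
  Matrix.of fun p =>
    let a := D.outEdge (p.1, true)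
    let t : ℤ[T;T⁻¹] := LaurentPolynomial.T 1
    if p.2 then D.outEdge p - D.inEdge p
    else if D.sign p.1 = 1 then (1 - t) • a + t • D.inEdge p - D.outEdge p
    else (1 - t) • a + t • D.outEdge p - D.inEdge p

/-- `Δ` is a greatest common divisor of the minors of size `N - 1` of the Alexander matrix, where
`N` is the number of generators. This determines `Δ` up to units `± t ^ k`. -/
def IsAlexanderPolynomial (D : GaussDiagram) (Δ : ℤ[T;T⁻¹]) : Prop :=
  ∀ q : ℤ[T;T⁻¹], q ∣ Δ ↔
    ∀ (r : Fin (Fintype.card D.Gen - 1) → D.Passage) (c : Fin (Fintype.card D.Gen - 1) → D.Gen),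
      q ∣ (D.alexanderMatrix.submatrix r c).det

end GaussDiagram

/-! ### Links -/

/-- An oriented link diagram on the sphere. -/
structure LinkDiagram extends GaussDiagram where
  planar : toGaussDiagram.IsPlanar

/-- Renaming the crossings, and the three Reidemeister moves. The first two are stated in the
direction in which the number of crossings drops. -/
inductive ReidemeisterMove : LinkDiagram → LinkDiagram → Prop
  | rename (D D' : LinkDiagram) (h : D.Forgets D'.toGaussDiagram ∅) : ReidemeisterMove D D'
  | one (D D' : LinkDiagram) (x : Fin D.numCrossings) (b : Bool)
      (hx : D.next (x, b) = (x, !b))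
      (h : D.Forgets D'.toGaussDiagram {x}) : ReidemeisterMove D D'
  | two (D D' : LinkDiagram) (x y : Fin D.numCrossings) (hxy : x ≠ y)
      (hsign : D.sign y = -D.sign x)
      (hover : D.next (x, true) = (y, true))
      (hunder : D.next (x, false) = (y, false) ∨ D.next (y, false) = (x, false))
      (h : D.Forgets D'.toGaussDiagram {x, y}) : ReidemeisterMove D D'
  | three (D D' : LinkDiagram) (x y z : Fin D.numCrossings)
      (hxyz : D.IsTriangle x y z)
      (h : D'.toGaussDiagram = D.slide x y z) : ReidemeisterMove D D'

/-- Oriented links up to isotopy: diagrams up to the equivalence relation generated by the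
Reidemeister moves. -/
def Link : Type := Quot ReidemeisterMove

namespace Link

/-- A link is alternating if it has an alternating diagram. -/
def IsAlternating (L : Link) : Prop :=
  ∃ D : LinkDiagram, Quot.mk ReidemeisterMove D = L ∧ D.IsAlternating

/-- `Δ` is the Alexander polynomial of `L` (up to units), computed from some diagram of `L`. -/
def IsAlexanderPolynomial (L : Link) (Δ : ℤ[T;T⁻¹]) : Prop :=
  ∃ D : LinkDiagram, Quot.mk ReidemeisterMove D = L ∧ D.IsAlexanderPolynomial Δ

end Link

/-! ### Sequences -/

def IsLogConcaveSeq (a : ℤ → ℤ) : Prop := ∀ i, a (i - 1) * a (i + 1) ≤ a i ^ 2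

def HasNoInternalZeros (a : ℤ → ℤ) : Prop :=
  ∀ i j k, i < j → j < k → a i ≠ 0 → a k ≠ 0 → a j ≠ 0

/-! ### Lorentzian polynomials -/

namespace MvPolynomial

/-- The iterated partial derivative `∂ ^ α`. -/
def iteratedPDeriv {m : ℕ} (α : Fin m → ℕ) (P : MvPolynomial (Fin m) ℝ) :
    MvPolynomial (Fin m) ℝ :=
  (List.finRange m).foldr (fun i Q => (pderiv i)^[α i] Q) P

/-- The Hessian matrix at the origin (for a quadratic form, its constant Hessian matrix). -/
def hessianMatrix {m : ℕ} (P : MvPolynomial (Fin m) ℝ) : Matrix (Fin m) (Fin m) ℝ :=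
  Matrix.of fun i j => coeff 0 (pderiv i (pderiv j P))

/-- `P` is homogeneous of degree `d` with nonnegative coefficients, and all its partial
derivatives of order `d - 2` are nondegenerate quadratic forms of signature `(1, m - 1)`. -/
def IsStrictlyLorentzian {m : ℕ} (d : ℕ) (P : MvPolynomial (Fin m) ℝ) : Prop :=
  P.IsHomogeneous d ∧ (∀ α, 0 ≤ P.coeff α) ∧
    ∀ α : Fin m → ℕ, (∑ i, α i) + 2 = d →
      sigPos (iteratedPDeriv α P).hessianMatrix.toQuadraticForm' = 1 ∧
      sigNeg (iteratedPDeriv α P).hessianMatrix.toQuadraticForm' + 1 = m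

/-- A homogeneous polynomial is Lorentzian if it is a (coefficientwise) limit of strictly
Lorentzian polynomials of the same degree in the same variables. -/
def IsLorentzian {m : ℕ} (P : MvPolynomial (Fin m) ℝ) : Prop :=
  ∃ d : ℕ, P.IsHomogeneous d ∧ ∃ Q : ℕ → MvPolynomial (Fin m) ℝ,
    (∀ n, IsStrictlyLorentzian d (Q n)) ∧
    ∀ α, Filter.Tendsto (fun n => (Q n).coeff α) Filter.atTop (𝓝 (P.coeff α))

/-- The divided power normalization `∑ c_α w ^ α ↦ ∑ c_α w ^ α / α!`. -/
def normalization {m : ℕ} (P : MvPolynomial (Fin m) ℝ) : MvPolynomial (Fin m) ℝ :=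
  ∑ α ∈ P.support, monomial α (P.coeff α / ∏ i, ((α i).factorial : ℝ))

def IsDenormalizedLorentzian {m : ℕ} (P : MvPolynomial (Fin m) ℝ) : Prop :=
  P.normalization.IsLorentzian

end MvPolynomial

/-- `Homog (P(-t))` in the variables `t = X 0` and `z = X 1`, with real coefficients. -/
def homogNeg (P : ℤ[X]) : MvPolynomial (Fin 2) ℝ :=
  let R : ℝ[X] := (P.comp (-Polynomial.X)).map (Int.castRingHom ℝ)
  R.homogenize R.natDegree

end

/-!
The proof has two independent halves.

*Topology.* The coefficients of `P(-t)` are nonnegative. A Laurent polynomial `Δ` is an Alexander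
polynomial of a diagram if it generates the smallest principal ideal that contains the minors of
corank one of the Alexander matrix, and this ideal of minors depends only on the module which the
matrix presents, as for any Fitting ideal (`minorIdeal_ker_eq`). The module in turn is determined by
its functor of points, the colorings of the edges of the diagram with values in an arbitrary module
that satisfy the relation of the Alexander quandle at each crossing (`SolEquiv.minorIdeal_eq`). For
each Reidemeister move a coloring of one diagram determines a coloring of the other one, so the
Alexander polynomial can be computed from any diagram of the link
(`Link.isAlexanderPolynomial_of_mk_eq`), in particular from an alternating one.

The columns of the Alexander matrix add up to zero. On a planar diagram the faces have an Alexander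
numbering (`IsPlanar.exists_numbering`): every circulation on the edges is the coboundary of a
function on the faces, because Euler's formula makes the dimensions agree. The numbering gives a
relation between the rows whose coefficients are units (`IsPlanar.exists_vecMul_alexanderMatrix`).
Hence, unless there are components without crossings, all cofactors are associated, and the
Alexander polynomial is any one of them (`dvd_minors_iff`). For an alternating diagram the rows can be matched with the edges such that at
`-t` the matrix becomes the Laplacian of a directed graph with weights `1` and `t`. By the
matrix-tree theorem (`det_laplacian_mem`) a cofactor is a sum of products of these weights. This is
Crowell's argument (`IsAlternating.exists_mem_alternatingCone`).

*Lorentzian polynomials.* For a form `∑ u k / (k! (d - k)!) * t ^ k * z ^ (d - k)` the Hessian of a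
derivative of order `d - 2` has the entries `u k`, `u (k + 1)`, `u (k + 2)`. It has signature
`(1, 1)` if and only if `u k * u (k + 2) < u (k + 1) ^ 2`
(`MvPolynomial.isStrictlyLorentzian_two_iff`). The limits of nonnegative sequences that are strictly
log-concave in this sense are the log-concave sequences without internal zeros: the condition
`u i * u k ≤ u (i + 1) * u (k - 1)` for `i < k`, which also excludes internal zeros, passes to the
limit, and conversely such a sequence can be approximated (`LogConcaveUpTo.of_tendsto`,
`LogConcaveUpTo.exists_tendsto`).
-/

noncomputable section

/-! ### Bivariate strictly Lorentzian polynomials -/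

theorem one_le_sigPos {Q : QuadraticForm ℝ (Fin 2 → ℝ)} {v : Fin 2 → ℝ} (hv : 0 < Q v) :
    1 ≤ sigPos Q := by
  have hv0 : v ≠ 0 := by rintro rfl; simp at hv
  have h := le_sigPos_of_posDef Q (V := Submodule.span ℝ {v}) ?_
  · rwa [finrank_span_singleton hv0] at h
  · rintro ⟨w, hw⟩ hw0
    obtain ⟨a, rfl⟩ := Submodule.mem_span_singleton.1 hw
    have ha : a ≠ 0 := by rintro rfl; simp at hw0
    have : 0 < a * a * Q v := mul_pos (mul_self_pos.2 ha) hv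
    simpa [QuadraticMap.restrict, QuadraticMap.map_smul] using this

theorem exists_pos_of_sigPos_eq_one {Q : QuadraticForm ℝ (Fin 2 → ℝ)} (h : sigPos Q = 1) :
    ∃ v, 0 < Q v := by
  obtain ⟨V, hV, hQ⟩ := exists_finrank_eq_sigPos_and_posDef Q
  rw [h] at hV
  obtain ⟨v, hv, -⟩ := finrank_eq_one_iff'.1 hV
  exact ⟨v, hQ v hv⟩

theorem sigPos_sigNeg_two_iff {M : Matrix (Fin 2) (Fin 2) ℝ} (hM : M 1 0 = M 0 1)
    (h0 : 0 ≤ M 0 0) (h1 : 0 ≤ M 1 1) :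
    sigPos M.toQuadraticForm' = 1 ∧ sigNeg M.toQuadraticForm' + 1 = 2 ↔
      M 0 0 * M 1 1 < M 0 1 ^ 2 := by
  have hQ (v : Fin 2 → ℝ) : M.toQuadraticForm' v =
      M 0 0 * v 0 ^ 2 + 2 * M 0 1 * (v 0 * v 1) + M 1 1 * v 1 ^ 2 := by
    simp [Matrix.toQuadraticForm', Matrix.toLinearMap₂'_apply', dotProduct, Matrix.mulVec,
      Fin.sum_univ_two, hM]
    ring
  constructor
  · rintro ⟨-, h⟩
    by_contra! hd
    obtain ⟨v, hv⟩ := exists_pos_of_sigPos_eq_one (Q := -M.toQuadraticForm') (by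
      rw [sigPos_neg]; omega)
    rw [neg_apply, hQ] at hv
    rcases h0.eq_or_lt with h0 | h0
    · have hb : M 0 1 = 0 := by
        rw [← h0, zero_mul] at hd
        exact pow_eq_zero_iff two_ne_zero |>.1 (le_antisymm hd (sq_nonneg _))
      rw [← h0, hb] at hv
      nlinarith [mul_nonneg h1 (sq_nonneg (v 1))]
    · have := mul_pos h0 hv
      nlinarith [sq_nonneg (M 0 0 * v 0 + M 0 1 * v 1),
        mul_nonneg (sub_nonneg.2 hd) (sq_nonneg (v 1))]
  · intro hd
    have hb : 0 < |M 0 1| := abs_pos.2 (by rintro h; rw [h] at hd; nlinarith [mul_nonneg h0 h1])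
    have hp : 1 ≤ sigPos M.toQuadraticForm' := by
      refine one_le_sigPos (v := ![1, SignType.sign (M 0 1)]) ?_
      rw [hQ]
      have := self_mul_sign (M 0 1)
      have h2 : (0 : ℝ) ≤ (SignType.sign (M 0 1) : ℝ) ^ 2 := sq_nonneg _
      simp only [Matrix.cons_val_zero, Matrix.cons_val_one]
      nlinarith [mul_nonneg h1 h2]
    have hn : 1 ≤ sigNeg M.toQuadraticForm' := by
      rw [← sigPos_neg]
      rcases h0.eq_or_lt with h0 | h0
      · refine one_le_sigPos (v := ![M 1 1 + 1, -M 0 1]) ?_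
        rw [neg_apply, hQ, ← h0]
        simp only [Matrix.cons_val_zero, Matrix.cons_val_one]
        have : 0 < M 0 1 ^ 2 := by rw [← sq_abs]; positivity
        nlinarith [mul_nonneg h1 this.le]
      · refine one_le_sigPos (v := ![M 0 1, -M 0 0]) ?_
        rw [neg_apply, hQ]
        simp only [Matrix.cons_val_zero, Matrix.cons_val_one]
        nlinarith
    have := QuadraticForm.sigPos_add_sigNeg_add_radical (Q := M.toQuadraticForm')
    rw [Module.finrank_fin_fun] at this
    omega

namespace MvPolynomial

/-- The exponent of the monomial `X 0 ^ a * X 1 ^ b`. -/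
def biexp (a b : ℕ) : Fin 2 →₀ ℕ := Finsupp.single 0 a + Finsupp.single 1 b

@[simp] theorem biexp_zero (a b : ℕ) : biexp a b 0 = a := by simp [biexp]
@[simp] theorem biexp_one (a b : ℕ) : biexp a b 1 = b := by simp [biexp]

/-- The divided coefficients `a! b! [X 0 ^ a X 1 ^ b] P`, that is, the values at the origin of the
partial derivatives of `P`. -/
def dcoeff (P : MvPolynomial (Fin 2) ℝ) (a b : ℕ) : ℝ :=
  a.factorial * b.factorial * P.coeff (biexp a b)

theorem dcoeff_pderiv_zero (P : MvPolynomial (Fin 2) ℝ) (a b : ℕ) :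
    dcoeff (pderiv 0 P) a b = dcoeff P (a + 1) b := by
  have : biexp a b + Finsupp.single 0 1 = biexp (a + 1) b := by
    ext i; fin_cases i <;> simp [biexp]
  rw [dcoeff, dcoeff, coeff_pderiv, this, Nat.factorial_succ]
  simp; ring

theorem dcoeff_pderiv_one (P : MvPolynomial (Fin 2) ℝ) (a b : ℕ) :
    dcoeff (pderiv 1 P) a b = dcoeff P a (b + 1) := by
  have : biexp a b + Finsupp.single 1 1 = biexp a (b + 1) := by
    ext i; fin_cases i <;> simp [biexp]
  rw [dcoeff, dcoeff, coeff_pderiv, this, Nat.factorial_succ]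
  simp; ring

theorem dcoeff_iterate_zero (P : MvPolynomial (Fin 2) ℝ) (n a b : ℕ) :
    dcoeff ((pderiv 0)^[n] P) a b = dcoeff P (a + n) b := by
  induction n generalizing a with
  | zero => rfl
  | succ n ih => rw [Function.iterate_succ_apply', dcoeff_pderiv_zero, ih]; congr 1; omega

theorem dcoeff_iterate_one (P : MvPolynomial (Fin 2) ℝ) (n a b : ℕ) :
    dcoeff ((pderiv 1)^[n] P) a b = dcoeff P a (b + n) := by
  induction n generalizing b with
  | zero => rfl
  | succ n ih => rw [Function.iterate_succ_apply', dcoeff_pderiv_one, ih]; congr 1; omega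

theorem dcoeff_iteratedPDeriv (P : MvPolynomial (Fin 2) ℝ) (α : Fin 2 → ℕ) (a b : ℕ) :
    dcoeff (iteratedPDeriv α P) a b = dcoeff P (a + α 0) (b + α 1) := by
  have : iteratedPDeriv α P = (pderiv 0)^[α 0] ((pderiv 1)^[α 1] P) := rfl
  rw [this, dcoeff_iterate_zero, dcoeff_iterate_one]

theorem coeff_zero_eq_dcoeff (P : MvPolynomial (Fin 2) ℝ) : P.coeff 0 = dcoeff P 0 0 := by
  simp [dcoeff, biexp]

theorem isStrictlyLorentzian_two_iff {d : ℕ} {P : MvPolynomial (Fin 2) ℝ} :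
    IsStrictlyLorentzian d P ↔ P.IsHomogeneous d ∧ (∀ α, 0 ≤ P.coeff α) ∧
      ∀ a b, a + b + 2 = d →
        dcoeff P a (b + 2) * dcoeff P (a + 2) b < dcoeff P (a + 1) (b + 1) ^ 2 := by
  refine and_congr_right fun _ => and_congr_right fun hP => ?_
  have key (α : Fin 2 → ℕ) : (sigPos (iteratedPDeriv α P).hessianMatrix.toQuadraticForm' = 1 ∧
      sigNeg (iteratedPDeriv α P).hessianMatrix.toQuadraticForm' + 1 = 2) ↔
      dcoeff P (α 0) (α 1 + 2) * dcoeff P (α 0 + 2) (α 1) <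
        dcoeff P (α 0 + 1) (α 1 + 1) ^ 2 := by
    have h (i j : ℕ) : 0 ≤ dcoeff P i j := mul_nonneg (by positivity) (hP _)
    rw [sigPos_sigNeg_two_iff] <;>
      simp only [hessianMatrix, Matrix.of_apply, coeff_zero_eq_dcoeff, dcoeff_pderiv_zero,
        dcoeff_pderiv_one, dcoeff_iteratedPDeriv] <;> ring_nf
    all_goals first | rfl | apply h
  constructor
  · intro h a b hab
    exact (key ![a, b]).1 (h ![a, b] (by simp [Fin.sum_univ_two, hab]))
  · intro h α hα
    rw [Fin.sum_univ_two] at hα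
    exact (key α).2 (h _ _ hα)

end MvPolynomial

/-! ### Limits of strictly log-concave sequences -/

section Limits

open Filter

/-- In a strictly log-concave sequence of nonnegative numbers the product of two entries grows
when they move towards each other. -/
theorem mul_le_mul_of_strictLogConcave {d : ℕ} {u : ℕ → ℝ} (h0 : ∀ k, 0 ≤ u k)
    (h : ∀ k, k + 2 ≤ d → u k * u (k + 2) < u (k + 1) ^ 2) (i n : ℕ) (hn : i + n + 1 ≤ d) :
    u i * u (i + n + 1) ≤ u (i + 1) * u (i + n) := by
  induction n with
  | zero => simp [mul_comm]
  | succ n ih =>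
    have hpos : 0 < u (i + n + 1) := by
      have := h (i + n) (by omega)
      refine (h0 _).lt_of_ne fun h => ?_
      rw [← h] at this
      nlinarith [mul_nonneg (h0 (i + n)) (h0 (i + n + 2))]
    have h1 := ih (by omega)
    have h2 := h (i + n) (by omega)
    rcases n.eq_zero_or_pos with rfl | hn'
    · simp only [add_zero, zero_add] at h2 ⊢
      rw [← sq]; exact h2.le
    have hpos' : 0 < u (i + n) := by
      obtain ⟨m, rfl⟩ : ∃ m, n = m + 1 := ⟨n - 1, by omega⟩
      have := h (i + m) (by omega)
      refine (h0 _).lt_of_ne fun h => ?_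
      rw [← add_assoc] at h
      rw [← h] at this
      nlinarith [mul_nonneg (h0 (i + m)) (h0 (i + m + 2))]
    rw [show i + (n + 1) + 1 = i + n + 2 by ring, show i + (n + 1) = i + n + 1 by ring]
    refine le_of_mul_le_mul_right ?_ hpos'
    refine le_of_mul_le_mul_right ?_ hpos
    have a1 := mul_le_mul_of_nonneg_right h1 (mul_nonneg (h0 (i + n)) (h0 (i + n + 2)))
    have a2 := mul_le_mul_of_nonneg_left h2.le (mul_nonneg (h0 (i + 1)) (h0 (i + n)))
    nlinarith

/-- A log-concave sequence of nonnegative numbers without internal zeros, on `0, …, d`. -/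
structure LogConcaveUpTo (d : ℕ) (u : ℕ → ℝ) : Prop where
  nonneg : ∀ k ≤ d, 0 ≤ u k
  logConcave : ∀ k, k + 2 ≤ d → u k * u (k + 2) ≤ u (k + 1) ^ 2
  no_internal_zeros : ∀ i j k, i < j → j < k → k ≤ d → u i ≠ 0 → u k ≠ 0 → u j ≠ 0

theorem LogConcaveUpTo.of_tendsto {d : ℕ} {u : ℕ → ℝ} {v : ℕ → ℕ → ℝ}
    (h0 : ∀ n k, 0 ≤ v n k) (h : ∀ n k, k + 2 ≤ d → v n k * v n (k + 2) < v n (k + 1) ^ 2)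
    (hlim : ∀ k ≤ d, Tendsto (fun n => v n k) atTop (𝓝 (u k))) : LogConcaveUpTo d u := by
  have hnn : ∀ k ≤ d, 0 ≤ u k := fun k hk => ge_of_tendsto' (hlim k hk) fun n => h0 n k
  have hex (i n : ℕ) (hn : i + n + 1 ≤ d) : u i * u (i + n + 1) ≤ u (i + 1) * u (i + n) :=
    le_of_tendsto_of_tendsto' ((hlim _ (by omega)).mul (hlim _ hn))
      ((hlim _ (by omega)).mul (hlim _ (by omega)))
      fun m => mul_le_mul_of_strictLogConcave (h0 m) (h m) i n hn
  refine ⟨hnn, fun k hk => ?_, ?_⟩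
  · have := hex k 1 hk
    rwa [← sq] at this
  · intro i j k hij hjk hkd hi hk
    obtain ⟨n, rfl⟩ : ∃ n, j = i + n := ⟨j - i, by omega⟩
    clear hij
    induction n with
    | zero => exact hi
    | succ n ih =>
      have hn := ih (by omega)
      obtain ⟨m, rfl⟩ : ∃ m, k = i + n + m + 1 := ⟨k - (i + n) - 1, by omega⟩
      have := hex (i + n) m hkd
      intro h
      rw [← add_assoc] at h
      rw [h, zero_mul] at this
      have h1 := (hnn _ (by omega)).lt_of_ne' hn
      have h2 := (hnn _ hkd).lt_of_ne' hk
      exact absurd (mul_pos h1 h2) (not_lt.2 this)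

theorem LogConcaveUpTo.exists_tendsto {d : ℕ} {u : ℕ → ℝ} (hu : LogConcaveUpTo d u)
    (hd : u d ≠ 0) : ∃ v : ℕ → ℕ → ℝ, (∀ n k, k ≤ d → 0 ≤ v n k) ∧
      (∀ n k, k + 2 ≤ d → v n k * v n (k + 2) < v n (k + 1) ^ 2) ∧
      ∀ k ≤ d, Tendsto (fun n => v n k) atTop (𝓝 (u k)) := by
  classical
  have hex : ∃ k, u k ≠ 0 := ⟨d, hd⟩
  obtain ⟨p, hp, hmin⟩ : ∃ p, u p ≠ 0 ∧ ∀ k < p, u k = 0 :=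
    ⟨Nat.find hex, Nat.find_spec hex, fun k hk => not_not.1 (Nat.find_min hex hk)⟩
  have hpd : p ≤ d := not_lt.1 fun h => hd (hmin d h)
  have hpos (k : ℕ) (h1 : p ≤ k) (h2 : k ≤ d) : 0 < u k := by
    refine (hu.nonneg k h2).lt_of_ne' ?_
    rcases h1.eq_or_lt with rfl | h1
    · exact hp
    rcases h2.eq_or_lt with rfl | h2
    · exact hd
    exact hu.no_internal_zeros p k d h1 h2 le_rfl hp hd
  have hp0 := hpos p le_rfl hpd
  -- extend the sequence geometrically below `p`, with a ratio `δ` that tends to zero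
  let δ : ℕ → ℝ := fun n => u p / (u p + |u (p + 1)|) * (1 / ((n : ℝ) + 1))
  have hδ0 (n : ℕ) : 0 < δ n := by positivity
  have hδ1 (n : ℕ) : δ n * u (p + 1) ≤ u p := by
    have h1 : 1 / ((n : ℝ) + 1) ≤ 1 := by
      rw [div_le_one (by positivity)]
      linarith [n.cast_nonneg (α := ℝ)]
    have h2 : δ n ≤ u p / (u p + |u (p + 1)|) := mul_le_of_le_one_right (by positivity) h1
    calc δ n * u (p + 1) ≤ δ n * (u p + |u (p + 1)|) :=
          mul_le_mul_of_nonneg_left (by linarith [le_abs_self (u (p + 1))]) (hδ0 n).le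
      _ ≤ u p / (u p + |u (p + 1)|) * (u p + |u (p + 1)|) :=
          mul_le_mul_of_nonneg_right h2 (by positivity)
      _ = u p := div_mul_cancel₀ _ (by positivity)
  have hδl : Tendsto δ atTop (𝓝 0) := by
    have := tendsto_one_div_add_atTop_nhds_zero_nat (𝕜 := ℝ)
    have h := this.const_mul (u p / (u p + |u (p + 1)|))
    rwa [mul_zero] at h
  let w : ℕ → ℕ → ℝ := fun n k => if p ≤ k then u k else u p * δ n ^ (p - k)
  have hw0 (n k : ℕ) (hk : k ≤ d) : 0 < w n k := by
    by_cases h : p ≤ k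
    · simpa [w, h] using hpos k h hk
    · simp only [w, h, if_false]
      have := hδ0 n
      positivity
  have hwlc (n k : ℕ) (hk : k + 2 ≤ d) : w n k * w n (k + 2) ≤ w n (k + 1) ^ 2 := by
    rcases lt_trichotomy (k + 1) p with h | h | h
    · obtain ⟨m, rfl⟩ : ∃ m, p = k + 2 + m := ⟨p - k - 2, by omega⟩
      have e0 : w n k = u (k + 2 + m) * δ n ^ (m + 2) := by
        simp only [w, if_neg (show ¬ (k + 2 + m ≤ k) by omega)]
        congr 2; omega
      have e1 : w n (k + 1) = u (k + 2 + m) * δ n ^ (m + 1) := by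
        simp only [w, if_neg (show ¬ (k + 2 + m ≤ k + 1) by omega)]
        congr 2; omega
      have e2 : w n (k + 2) = u (k + 2 + m) * δ n ^ m := by
        rcases m.eq_zero_or_pos with rfl | hm
        · simp [w]
        · simp only [w, if_neg (show ¬ (k + 2 + m ≤ k + 2) by omega)]
          congr 2; omega
      rw [e0, e1, e2]
      apply le_of_eq
      ring
    · subst h
      have e0 : w n k = u (k + 1) * δ n := by simp [w]
      have e1 : w n (k + 1) = u (k + 1) := by simp [w]
      have e2 : w n (k + 2) = u (k + 2) := by simp [w]
      rw [e0, e1, e2]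
      nlinarith [mul_le_mul_of_nonneg_left (hδ1 n) hp0.le]
    · have e0 : w n k = u k := if_pos (by omega)
      have e1 : w n (k + 1) = u (k + 1) := if_pos (by omega)
      have e2 : w n (k + 2) = u (k + 2) := if_pos (by omega)
      rw [e0, e1, e2]
      exact hu.logConcave k hk
  -- the factors `r ^ k ^ 2` make the inequalities strict
  let r : ℕ → ℝ := fun n => 1 - 1 / ((n : ℝ) + 2)
  have hr0 (n : ℕ) : 0 < r n := by
    have : 1 / ((n : ℝ) + 2) < 1 := by
      rw [div_lt_one (by positivity)]
      linarith [n.cast_nonneg (α := ℝ)]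
    simp only [r]; linarith
  have hr1 (n : ℕ) : r n < 1 := by
    have : 0 < 1 / ((n : ℝ) + 2) := by positivity
    simp only [r]; linarith
  have hrl : Tendsto r atTop (𝓝 1) := by
    have h := (tendsto_one_div_add_atTop_nhds_zero_nat (𝕜 := ℝ)).comp (tendsto_add_atTop_nat 1)
    have h2 := h.const_sub 1
    rw [sub_zero] at h2
    refine h2.congr fun n => ?_
    simp only [Function.comp, r]
    push_cast
    ring_nf
  refine ⟨fun n k => r n ^ k ^ 2 * w n k, fun n k hk => ?_, fun n k hk => ?_, fun k hk => ?_⟩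
  · exact (mul_pos (pow_pos (hr0 n) _) (hw0 n k hk)).le
  · have h1 : r n ^ k ^ 2 * r n ^ (k + 2) ^ 2 = r n ^ 2 * (r n ^ (k + 1) ^ 2) ^ 2 := by ring
    have h2 : 0 < (r n ^ (k + 1) ^ 2) ^ 2 * w n (k + 1) ^ 2 := by
      have := hr0 n
      have := hw0 n (k + 1) (by omega)
      positivity
    have h3 : r n ^ 2 < 1 := pow_lt_one₀ (hr0 n).le (hr1 n) two_ne_zero
    calc r n ^ k ^ 2 * w n k * (r n ^ (k + 2) ^ 2 * w n (k + 2))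
        = (r n ^ k ^ 2 * r n ^ (k + 2) ^ 2) * (w n k * w n (k + 2)) := by ring
      _ = r n ^ 2 * ((r n ^ (k + 1) ^ 2) ^ 2 * (w n k * w n (k + 2))) := by rw [h1]; ring
      _ ≤ r n ^ 2 * ((r n ^ (k + 1) ^ 2) ^ 2 * w n (k + 1) ^ 2) := by
          gcongr
          exact hwlc n k hk
      _ < (r n ^ (k + 1) ^ 2) ^ 2 * w n (k + 1) ^ 2 := mul_lt_of_lt_one_left h2 h3
      _ = _ := by ring
  · have h1 : Tendsto (fun n => w n k) atTop (𝓝 (u k)) := by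
      by_cases h : p ≤ k
      · simp [w, h]
      · rw [hmin k (not_le.1 h)]
        simp only [w, h, if_false]
        have := (hδl.pow (p - k)).const_mul (u p)
        rwa [zero_pow (by omega), mul_zero] at this
    simpa using (hrl.pow (k ^ 2)).mul h1

namespace MvPolynomial

theorem coeff_normalization {m : ℕ} (P : MvPolynomial (Fin m) ℝ) (α : Fin m →₀ ℕ) :
    P.normalization.coeff α = P.coeff α / ∏ i, ((α i).factorial : ℝ) := by
  rw [normalization, coeff_sum]
  simp only [coeff_monomial]
  rw [Finset.sum_ite_eq' P.support α]
  split_ifs with h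
  · rfl
  · rw [notMem_support_iff.1 h, zero_div]

theorem dcoeff_normalization (P : MvPolynomial (Fin 2) ℝ) (a b : ℕ) :
    P.normalization.dcoeff a b = P.coeff (biexp a b) := by
  rw [dcoeff, coeff_normalization, Fin.prod_univ_two, biexp_zero, biexp_one]
  field_simp

theorem normalization_isHomogeneous {m d : ℕ} {P : MvPolynomial (Fin m) ℝ}
    (h : P.IsHomogeneous d) : P.normalization.IsHomogeneous d := by
  intro α hα
  refine h (d := α) fun h0 => hα ?_
  rw [coeff_normalization, h0, zero_div]

/-- The polynomial with divided coefficients `v k` at `t ^ k z ^ (d - k)`. -/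
def ofDcoeff (d : ℕ) (v : ℕ → ℝ) : MvPolynomial (Fin 2) ℝ :=
  (∑ k ∈ Finset.range (d + 1),
    Polynomial.monomial k (v k / (k.factorial * (d - k).factorial))).homogenize d

theorem coeff_ofDcoeff (d : ℕ) (v : ℕ → ℝ) (α : Fin 2 →₀ ℕ) :
    (ofDcoeff d v).coeff α = if α 0 + α 1 = d then
      v (α 0) / ((α 0).factorial * (α 1).factorial) else 0 := by
  rw [ofDcoeff, Polynomial.coeff_homogenize]
  split_ifs with h
  · simp only [Polynomial.finsetSum_coeff, Polynomial.coeff_monomial]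
    rw [Finset.sum_ite_eq' (Finset.range (d + 1)) (α 0), if_pos (Finset.mem_range.2 (by omega)),
      show d - α 0 = α 1 by omega]
  · rfl

theorem dcoeff_ofDcoeff {d : ℕ} (v : ℕ → ℝ) {a b : ℕ} (h : a + b = d) :
    (ofDcoeff d v).dcoeff a b = v a := by
  rw [dcoeff, coeff_ofDcoeff]
  simp only [biexp_zero, biexp_one, h, if_true]
  field_simp

/-- A homogenized univariate polynomial is denormalized Lorentzian exactly if its coefficients
are nonnegative and log-concave without internal zeros. -/
theorem isDenormalizedLorentzian_homogenize_iff {R : ℝ[X]} (hR : R ≠ 0) :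
    (R.homogenize R.natDegree).IsDenormalizedLorentzian ↔
      LogConcaveUpTo R.natDegree R.coeff := by
  set d := R.natDegree with hd
  have hcoeff (a b : ℕ) (hab : a + b = d) :
      (R.homogenize d).normalization.dcoeff a b = R.coeff a := by
    rw [dcoeff_normalization, Polynomial.coeff_homogenize]
    simp [hab]
  have hhom : (R.homogenize d).normalization.IsHomogeneous d :=
    normalization_isHomogeneous (R.isHomogeneous_homogenize)
  have hlead : R.coeff d ≠ 0 := by simpa [hd] using hR
  constructor
  · rintro ⟨d', hd', Q, hQ, hlim⟩
    have hne : (R.homogenize d).normalization ≠ 0 := by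
      intro h
      have := hcoeff d 0 rfl
      rw [h] at this
      exact hlead (by simpa [dcoeff] using this.symm)
    obtain rfl : d' = d := hd'.inj_right hhom hne
    refine LogConcaveUpTo.of_tendsto (v := fun n k => (Q n).dcoeff k (d - k)) ?_ ?_ ?_
    · exact fun n k => mul_nonneg (by positivity) ((hQ n).2.1 _)
    · intro n k hk
      have := (isStrictlyLorentzian_two_iff.1 (hQ n)).2.2 k (d - (k + 2)) (by omega)
      rw [show d - (k + 2) + 2 = d - k by omega,
        show d - (k + 2) + 1 = d - (k + 1) by omega] at this
      exact this
    · intro k hk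
      rw [← hcoeff k (d - k) (by omega)]
      exact (hlim _).const_mul _
  · intro h
    obtain ⟨v, hv0, hv, hlim⟩ := h.exists_tendsto hlead
    refine ⟨d, hhom, fun n => ofDcoeff d (v n), fun n => ?_, fun α => ?_⟩
    · refine isStrictlyLorentzian_two_iff.2 ⟨Polynomial.isHomogeneous_homogenize _, ?_, ?_⟩
      · intro α
        rw [coeff_ofDcoeff]
        split_ifs with hα
        · exact div_nonneg (hv0 n _ (by omega)) (by positivity)
        · rfl
      · intro a b hab
        rw [dcoeff_ofDcoeff _ (by omega), dcoeff_ofDcoeff _ (by omega),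
          dcoeff_ofDcoeff _ (by omega)]
        exact hv n a (by omega)
    · simp only [coeff_ofDcoeff, coeff_normalization, Polynomial.coeff_homogenize,
        Fin.prod_univ_two]
      split_ifs with hα
      · exact (hlim _ (by omega)).div_const _
      · simp

theorem zero_isDenormalizedLorentzian :
    (0 : MvPolynomial (Fin 2) ℝ).IsDenormalizedLorentzian := by
  refine ⟨0, normalization_isHomogeneous (isHomogeneous_zero _ _ _), fun _ => 0, fun n => ?_, ?_⟩
  · exact ⟨isHomogeneous_zero _ _ _, by simp, fun α h => by omega⟩
  · simp [coeff_normalization]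

end MvPolynomial

end Limits

/-! ### Ideals of minors and presentations of modules -/

section Minors

variable {R V W : Type*} [CommRing R] [AddCommGroup V] [Module R V] [AddCommGroup W] [Module R W]

/-- A multilinear map with values in an ideal on a set has values in the ideal on its span. -/
theorem MultilinearMap.mem_of_forall_mem_span {ι : Type*} [Finite ι]
    (f : MultilinearMap R (fun _ : ι => V) R) (I : Ideal R) (S : Set V)
    (h : ∀ w : ι → V, (∀ i, w i ∈ S) → f w ∈ I) (w : ι → V)
    (hw : ∀ i, w i ∈ Submodule.span R S) : f w ∈ I := by
  classical
  have := Fintype.ofFinite ι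
  suffices key : ∀ (T : Finset ι) (w : ι → V), (∀ i ∈ T, w i ∈ Submodule.span R S) →
      (∀ i ∉ T, w i ∈ S) → f w ∈ I from key Finset.univ w (fun i _ => hw i) (by simp)
  intro T
  induction T using Finset.induction_on with
  | empty => exact fun w _ h' => h w fun i => h' i (Finset.notMem_empty i)
  | insert a T ha ih =>
    intro w h1 h2
    have key : ∀ v ∈ Submodule.span R S, f (Function.update w a v) ∈ I := by
      intro v hv
      induction hv using Submodule.span_induction with
      | mem v hv =>
        refine ih _ (fun i hi => ?_) (fun i hi => ?_)
        · rw [Function.update_of_ne (by rintro rfl; exact ha hi)]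
          exact h1 i (Finset.mem_insert_of_mem hi)
        · by_cases hia : i = a
          · subst hia; simpa using hv
          · rw [Function.update_of_ne hia]
            exact h2 i (by simp [hia, hi])
      | zero => simp
      | add x y _ _ hx hy => rw [f.map_update_add]; exact I.add_mem hx hy
      | smul r x _ hx => rw [f.map_update_smul]; exact I.mul_mem_left _ hx
    simpa using key (w a) (h1 a (Finset.mem_insert_self a T))

/-- The ideal generated by the minors of size `k` of a submodule `K`, read as a matrix with rows
the elements of `K` and columns the linear forms on the ambient module. -/
def minorIdeal (K : Submodule R V) (k : ℕ) : Ideal R :=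
  Ideal.span {x | ∃ (φ : Fin k → V →ₗ[R] R) (w : Fin k → V), (∀ i, w i ∈ K) ∧
    (Matrix.of fun i j => φ j (w i)).det = x}

theorem det_mem_minorIdeal {K : Submodule R V} {k : ℕ} (φ : Fin k → V →ₗ[R] R) (w : Fin k → V)
    (hw : ∀ i, w i ∈ K) : (Matrix.of fun i j => φ j (w i)).det ∈ minorIdeal K k :=
  Ideal.subset_span ⟨φ, w, hw, rfl⟩

theorem minorIdeal_le_iff {K : Submodule R V} {k : ℕ} {I : Ideal R} :
    minorIdeal K k ≤ I ↔ ∀ (φ : Fin k → V →ₗ[R] R) (w : Fin k → V), (∀ i, w i ∈ K) →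
      (Matrix.of fun i j => φ j (w i)).det ∈ I := by
  refine ⟨fun h φ w hw => h (det_mem_minorIdeal φ w hw), fun h => Ideal.span_le.2 ?_⟩
  rintro _ ⟨φ, w, hw, rfl⟩
  exact h φ w hw

theorem minorIdeal_le_of_map_le {K : Submodule R V} {L : Submodule R W} (e : V ≃ₗ[R] W)
    (h : ∀ v ∈ K, e v ∈ L) (k : ℕ) : minorIdeal K k ≤ minorIdeal L k := by
  refine minorIdeal_le_iff.2 fun φ w hw => ?_
  have := det_mem_minorIdeal (K := L) (fun j => φ j ∘ₗ (e.symm : W →ₗ[R] V)) (fun i => e (w i))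
    fun i => h _ (hw i)
  simpa using this

theorem minorIdeal_eq_of_equiv {K : Submodule R V} {L : Submodule R W} (e : V ≃ₗ[R] W)
    (h : ∀ v, e v ∈ L ↔ v ∈ K) (k : ℕ) : minorIdeal K k = minorIdeal L k :=
  le_antisymm (minorIdeal_le_of_map_le e (fun v hv => (h v).2 hv) k)
    (minorIdeal_le_of_map_le e.symm (fun v hv => (h _).1 (by simpa using hv)) k)

theorem det_bordered {k : ℕ} (M : Matrix (Fin k) (Fin k) R) (r α : Fin k → R) :
    (Matrix.of fun i j => M i j + r i * α j).det =
      (Matrix.of (Fin.cons (Fin.cons 1 α) fun i => Fin.cons (-r i) (M i)) :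
        Matrix (Fin (k + 1)) (Fin (k + 1)) R).det := by
  have h := Matrix.det_eq_of_forall_row_eq_smul_add_const
    (A := (Matrix.of (Fin.cons (Fin.cons 1 α) fun i => Fin.cons 0 fun j => M i j + r i * α j) :
        Matrix (Fin (k + 1)) (Fin (k + 1)) R))
    (B := (Matrix.of (Fin.cons (Fin.cons 1 α) fun i => Fin.cons (-r i) (M i)) :
        Matrix (Fin (k + 1)) (Fin (k + 1)) R)) (Fin.cons 0 r) 0 rfl (by
      intro i j
      refine Fin.cases ?_ (fun i => ?_) i <;> refine Fin.cases ?_ (fun j => ?_) j <;> simp)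
  rw [← h, Matrix.det_succ_column_zero, Fin.sum_univ_succ]
  simp [Matrix.submatrix]

theorem minorIdeal_prod_top (K : Submodule R V) (k : ℕ) :
    minorIdeal (K.prod (⊤ : Submodule R R)) (k + 1) = minorIdeal K k := by
  apply le_antisymm
  · refine minorIdeal_le_iff.2 fun φ w hw => ?_
    have hφ (i j : Fin (k + 1)) : φ j (w i) =
        (φ j ∘ₗ LinearMap.inl R V R) (w i).1 + (w i).2 * φ j (0, 1) := by
      rw [← smul_eq_mul, ← map_smul, LinearMap.comp_apply, LinearMap.inl_apply, ← map_add]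
      simp
    simp only [hφ]
    set ψ : Fin (k + 1) → V →ₗ[R] R := fun j => φ j ∘ₗ LinearMap.inl R V R
    have hv : ∀ i, (w i).1 ∈ K := fun i => (hw i).1
    have := det_bordered (Matrix.of fun i j => ψ j (w i).1) (fun i => (w i).2)
      (fun j => φ j (0, 1))
    simp only [Matrix.of_apply] at this
    rw [this, Matrix.det_succ_column_zero]
    -- after deleting a row, at most the first row is not one of the rows with entries `ψ j v`
    refine Ideal.sum_mem _ fun i _ => Ideal.mul_mem_left _ _ ?_
    rw [Matrix.det_succ_row_zero]
    refine Ideal.sum_mem _ fun j _ => Ideal.mul_mem_left _ _ ?_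
    refine Fin.cases ?_ (fun i => ?_) i
    · convert det_mem_minorIdeal (K := K) (fun b => ψ (j.succAbove b)) (fun a => (w a.succ).1)
        (fun a => hv _) using 2
      ext a b
      simp
    · convert det_mem_minorIdeal (K := K) (fun b => ψ (j.succAbove b))
        (fun a => (w (i.succAbove a)).1) (fun a => hv _) using 2
      ext a b
      simp [Fin.succ_succAbove_succ]
  · refine minorIdeal_le_iff.2 fun φ w hw => ?_
    have := det_mem_minorIdeal (K := K.prod (⊤ : Submodule R R))
      (Fin.cons (LinearMap.snd R V R) fun j => φ j ∘ₗ LinearMap.fst R V R)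
      (Fin.cons (0, 1) fun i => (w i, 0)) (fun i => by
        refine Fin.cases ?_ (fun i => ?_) i
        · simp
        · simpa using hw i)
    rw [Matrix.det_succ_row_zero, Fin.sum_univ_succ] at this
    simpa [Matrix.submatrix] using this

theorem minorIdeal_prod_pi_top (K : Submodule R V) (k n : ℕ) :
    minorIdeal (K.prod (⊤ : Submodule R (Fin n → R))) (k + n) = minorIdeal K k := by
  induction n with
  | zero =>
    refine minorIdeal_eq_of_equiv LinearEquiv.prodUnique (fun v => ?_) k
    simp [Submodule.mem_prod]
  | succ n ih =>
    rw [← ih, ← minorIdeal_prod_top (K.prod (⊤ : Submodule R (Fin n → R))) (k + n)]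
    refine minorIdeal_eq_of_equiv
      ((LinearEquiv.prodCongr (LinearEquiv.refl R V)
        ((Fin.consLinearEquiv R fun _ => R).symm ≪≫ₗ LinearEquiv.prodComm R _ _)) ≪≫ₗ
          (LinearEquiv.prodAssoc R _ _ _).symm) (fun v => ?_) _
    simp only [Submodule.mem_prod, Submodule.mem_top, and_true]
    rfl

theorem minorIdeal_ker_coprod {A κ : Type*} [AddCommGroup A] [Module R A] [Fintype κ]
    (f : V →ₗ[R] A) (hf : Function.Surjective f) (g : (κ → R) →ₗ[R] A) (k : ℕ) :
    minorIdeal (LinearMap.ker (f.coprod g)) (k + Fintype.card κ) =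
      minorIdeal (LinearMap.ker f) k := by
  obtain ⟨s, hs⟩ := Module.projective_lifting_property f g hf
  rw [← minorIdeal_prod_pi_top (LinearMap.ker f) k (Fintype.card κ)]
  let shear : (V × (κ → R)) ≃ₗ[R] (V × (κ → R)) :=
    LinearEquiv.ofLinearMap
      ((LinearMap.fst R V (κ → R) + s ∘ₗ LinearMap.snd R V (κ → R)).prod (LinearMap.snd R V _))
      ((LinearMap.fst R V (κ → R) - s ∘ₗ LinearMap.snd R V (κ → R)).prod (LinearMap.snd R V _))
      (by ext <;> simp) (by ext <;> simp)
  refine minorIdeal_eq_of_equiv (shear ≪≫ₗ LinearEquiv.prodCongr (LinearEquiv.refl R V)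
    (LinearEquiv.funCongrLeft R R (Fintype.equivFin κ).symm)) (fun v => ?_) _
  have : f (s v.2) = g v.2 := by rw [← hs]; rfl
  simp [Submodule.mem_prod, shear, this]

/-- The ideal of the minors of corank one of a presentation depends only on the presented
module. -/
theorem minorIdeal_ker_eq {A ι κ : Type*} [AddCommGroup A] [Module R A]
    [Fintype ι] [Fintype κ] [Nonempty ι] [Nonempty κ]
    (f : (ι → R) →ₗ[R] A) (hf : Function.Surjective f)
    (g : (κ → R) →ₗ[R] A) (hg : Function.Surjective g) :
    minorIdeal (LinearMap.ker f) (Fintype.card ι - 1) =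
      minorIdeal (LinearMap.ker g) (Fintype.card κ - 1) := by
  rw [← minorIdeal_ker_coprod f hf g, ← minorIdeal_ker_coprod g hg f]
  have h1 := Fintype.card_pos (α := ι)
  have h2 := Fintype.card_pos (α := κ)
  rw [show Fintype.card κ - 1 + Fintype.card ι = Fintype.card ι - 1 + Fintype.card κ by omega]
  refine minorIdeal_eq_of_equiv (LinearEquiv.prodComm R _ _) (fun v => ?_) _
  simp [add_comm]

/-- For a submodule spanned by the rows of a matrix the minors of the matrix suffice. -/
theorem minorIdeal_span_range_le_iff {m ι : Type*} [Fintype ι] [DecidableEq ι] (M : Matrix m ι R)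
    (k : ℕ) (I : Ideal R) :
    minorIdeal (Submodule.span R (Set.range M)) k ≤ I ↔
      ∀ (r : Fin k → m) (c : Fin k → ι), (M.submatrix r c).det ∈ I := by
  rw [minorIdeal_le_iff]
  constructor
  · intro h r c
    exact h (fun j => LinearMap.proj (c j)) (fun i => M (r i))
      fun i => Submodule.subset_span ⟨r i, rfl⟩
  · intro h φ w hw
    let f (φ : Fin k → (ι → R) →ₗ[R] R) : MultilinearMap R (fun _ : Fin k => ι → R) R :=
      (Matrix.detRowAlternating (R := R) (n := Fin k)).toMultilinearMap.compLinearMap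
        fun _ => LinearMap.pi φ
    let g (w : Fin k → ι → R) : MultilinearMap R (fun _ : Fin k => (ι → R) →ₗ[R] R) R :=
      (Matrix.detRowAlternating (R := R) (n := Fin k)).toMultilinearMap.compLinearMap
        fun _ => LinearMap.pi fun i => LinearMap.applyₗ (w i)
    have hf (φ : Fin k → (ι → R) →ₗ[R] R) (w : Fin k → ι → R) :
        f φ w = (Matrix.of fun i j => φ j (w i)).det := rfl
    have hg (φ : Fin k → (ι → R) →ₗ[R] R) (w : Fin k → ι → R) :
        g w φ = (Matrix.of fun i j => φ j (w i)).det := by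
      rw [← Matrix.det_transpose]; rfl
    rw [← hf]
    refine MultilinearMap.mem_of_forall_mem_span _ I (Set.range M) (fun w hw => ?_) w hw
    rw [hf, ← hg]
    refine MultilinearMap.mem_of_forall_mem_span _ I
      (Set.range fun i : ι => LinearMap.proj i) (fun φ hφ => ?_) φ (fun j => ?_)
    · choose r hr using hw
      choose c hc using hφ
      convert h r c
      rw [hg]
      congr 1
      ext i j
      simp [← hr, ← hc]
    · have : φ j = ∑ i, φ j (Pi.single i 1) • (LinearMap.proj i : (ι → R) →ₗ[R] R) := by
        ext i
        simp [Pi.single_apply]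
      rw [this]
      exact Submodule.sum_mem _ fun i _ =>
        Submodule.smul_mem _ _ (Submodule.subset_span ⟨i, rfl⟩)

end Minors

/-! ### Modules through their functor of solutions -/

section Solutions

variable {R : Type} [CommRing R]

/-- A property of families with values in `R`-modules, such as solving a system of linear
equations. -/
abbrev FamilyProp (R : Type) [CommRing R] (ι : Type) : Type 1 :=
  ∀ (X : Type) [AddCommGroup X] [Module R X], (ι → X) → Prop

/-- The families with the properties `P` and `Q` correspond to each other, naturally in the
module in which they take their values. -/
def SolEquiv {ι κ : Type} (P : FamilyProp R ι) (Q : FamilyProp R κ) : Prop :=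
  ∃ (F : ∀ (X : Type) [AddCommGroup X] [Module R X], (ι → X) → (κ → X))
    (G : ∀ (X : Type) [AddCommGroup X] [Module R X], (κ → X) → (ι → X)),
    (∀ (X : Type) [AddCommGroup X] [Module R X] (c : ι → X), P X c →
      Q X (F X c) ∧ G X (F X c) = c) ∧
    (∀ (X : Type) [AddCommGroup X] [Module R X] (c : κ → X), Q X c →
      P X (G X c) ∧ F X (G X c) = c) ∧
    (∀ (X Y : Type) [AddCommGroup X] [Module R X] [AddCommGroup Y] [Module R Y] (f : X →ₗ[R] Y)
      (c : ι → X), F Y (f ∘ c) = f ∘ F X c) ∧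
    (∀ (X Y : Type) [AddCommGroup X] [Module R X] [AddCommGroup Y] [Module R Y] (f : X →ₗ[R] Y)
      (c : κ → X), G Y (f ∘ c) = f ∘ G X c)

theorem SolEquiv.symm {ι κ : Type} {P : FamilyProp R ι} {Q : FamilyProp R κ} :
    SolEquiv P Q → SolEquiv Q P := fun ⟨F, G, h1, h2, h3, h4⟩ => ⟨G, F, h2, h1, h4, h3⟩

theorem SolEquiv.trans {ι κ μ : Type} {P : FamilyProp R ι} {Q : FamilyProp R κ}
    {S : FamilyProp R μ} : SolEquiv P Q → SolEquiv Q S → SolEquiv P S := by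
  rintro ⟨F, G, h1, h2, h3, h4⟩ ⟨F', G', h1', h2', h3', h4'⟩
  refine ⟨fun X _ _ c => F' X (F X c), fun X _ _ c => G X (G' X c), ?_, ?_, ?_, ?_⟩
  · intro X _ _ c hc
    obtain ⟨ha, hb⟩ := h1 X c hc
    obtain ⟨ha', hb'⟩ := h1' X _ ha
    exact ⟨ha', by dsimp only; rw [hb', hb]⟩
  · intro X _ _ c hc
    obtain ⟨ha, hb⟩ := h2' X c hc
    obtain ⟨ha', hb'⟩ := h2 X _ ha
    exact ⟨ha', by dsimp only; rw [hb', hb]⟩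
  · intro X Y _ _ _ _ f c
    dsimp only
    rw [h3 X Y, h3' X Y]
  · intro X Y _ _ _ _ f c
    dsimp only
    rw [h4' X Y, h4 X Y]

theorem SolEquiv.of_iff {ι : Type} {P Q : FamilyProp R ι}
    (h : ∀ (X : Type) [AddCommGroup X] [Module R X] (c : ι → X), P X c ↔ Q X c) :
    SolEquiv P Q :=
  ⟨fun _ _ _ c => c, fun _ _ _ c => c, fun X _ _ c hc => ⟨(h X c).1 hc, rfl⟩,
    fun X _ _ c hc => ⟨(h X c).2 hc, rfl⟩, fun _ _ _ _ _ _ _ _ => rfl, fun _ _ _ _ _ _ _ _ => rfl⟩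

/-- The family `c` solves the homogeneous linear system with the matrix `M`. -/
def IsSolution {m ι : Type} [Fintype ι] (M : Matrix m ι R) : FamilyProp R ι :=
  fun _ _ _ c => ∀ p, ∑ g, M p g • c g = 0

variable {m n ι κ : Type} [Fintype ι] [Fintype κ] [DecidableEq ι] [DecidableEq κ]

/-- The module presented by a matrix, with generators the columns and relations the rows. -/
abbrev PresentedModule (M : Matrix m ι R) : Type :=
  (ι → R) ⧸ Submodule.span R (Set.range M)

/-- The generators of the presented module, which form the universal solution. -/
def universalSolution (M : Matrix m ι R) (g : ι) : PresentedModule M :=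
  Submodule.Quotient.mk (Pi.single g 1)

theorem isSolution_universalSolution (M : Matrix m ι R) :
    IsSolution M (PresentedModule M) (universalSolution M) := by
  intro p
  have h : ∑ g, M p g • universalSolution M g = Submodule.mkQ _ (M p) := by
    conv_rhs => rw [← Finset.univ_sum_single (M p), map_sum]
    refine Finset.sum_congr rfl fun g _ => ?_
    rw [universalSolution, ← Submodule.mkQ_apply, ← map_smul, ← Pi.single_smul, smul_eq_mul,
      mul_one]
  rw [h, Submodule.mkQ_apply, Submodule.Quotient.mk_eq_zero]
  exact Submodule.subset_span ⟨p, rfl⟩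

theorem exists_linearMap_of_isSolution {M : Matrix m ι R} {X : Type} [AddCommGroup X] [Module R X]
    {c : ι → X} (hc : IsSolution M X c) :
    ∃ f : PresentedModule M →ₗ[R] X, f ∘ universalSolution M = c := by
  refine ⟨Submodule.liftQ _ (Fintype.linearCombination R c) ?_, ?_⟩
  · rw [Submodule.span_le]
    rintro _ ⟨p, rfl⟩
    simpa [Fintype.linearCombination_apply] using hc p
  · ext g
    simp [universalSolution, Submodule.liftQ_apply]

theorem PresentedModule.hom_ext {M : Matrix m ι R} {X : Type} [AddCommGroup X] [Module R X]
    {f f' : PresentedModule M →ₗ[R] X} (h : f ∘ universalSolution M = f' ∘ universalSolution M) :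
    f = f' := by
  refine Submodule.linearMap_qext _ (LinearMap.pi_ext' fun g => LinearMap.ext_ring ?_)
  exact congrFun h g

/-- Linear systems with corresponding solutions have the same minors of corank one. -/
theorem SolEquiv.minorIdeal_eq [Nonempty ι] [Nonempty κ] {M : Matrix m ι R} {N : Matrix n κ R}
    (h : SolEquiv (IsSolution M) (IsSolution N)) :
    minorIdeal (Submodule.span R (Set.range M)) (Fintype.card ι - 1) =
      minorIdeal (Submodule.span R (Set.range N)) (Fintype.card κ - 1) := by
  obtain ⟨F, G, h1, h2, h3, h4⟩ := h
  obtain ⟨β, hβ⟩ := exists_linearMap_of_isSolution (h1 _ _ (isSolution_universalSolution M)).1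
  obtain ⟨α, hα⟩ := exists_linearMap_of_isSolution (h2 _ _ (isSolution_universalSolution N)).1
  have hαβ : α ∘ₗ β = LinearMap.id := PresentedModule.hom_ext <| by
    rw [LinearMap.coe_comp, Function.comp_assoc, hβ, ← h3, hα,
      (h2 _ _ (isSolution_universalSolution N)).2]
    rfl
  have hβα : β ∘ₗ α = LinearMap.id := PresentedModule.hom_ext <| by
    rw [LinearMap.coe_comp, Function.comp_assoc, hα, ← h4, hβ,
      (h1 _ _ (isSolution_universalSolution M)).2]
    rfl
  let e : PresentedModule N ≃ₗ[R] PresentedModule M := LinearEquiv.ofLinearMap β α hβα hαβ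
  have := minorIdeal_ker_eq (Submodule.mkQ (Submodule.span R (Set.range M)))
    (Submodule.mkQ_surjective _) (e.toLinearMap ∘ₗ Submodule.mkQ (Submodule.span R (Set.range N)))
    (e.surjective.comp (Submodule.mkQ_surjective _))
  rwa [LinearEquiv.ker_comp, Submodule.ker_mkQ, Submodule.ker_mkQ] at this

end Solutions

namespace GaussDiagram

variable (D : GaussDiagram)

theorem isAlexanderPolynomial_iff_minorIdeal (Δ : ℤ[T;T⁻¹]) : D.IsAlexanderPolynomial Δ ↔
    ∀ q, q ∣ Δ ↔ minorIdeal (Submodule.span ℤ[T;T⁻¹] (Set.range D.alexanderMatrix))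
      (Fintype.card D.Gen - 1) ≤ Ideal.span {q} := by
  simp only [IsAlexanderPolynomial, minorIdeal_span_range_le_iff, Ideal.mem_span_singleton]

/-- The relation at a passage between the colors of the edges: an over-passage does not change the
color, an under-passage acts by the color of the over-strand. -/
def PassageRel {X : Type} [AddCommGroup X] [Module ℤ[T;T⁻¹] X] (c : D.Gen → X) (p : D.Passage) :
    Prop :=
  if p.2 then c (.inl p) = c (.inl (D.next.symm p))
  else if D.sign p.1 = 1 then
    (1 - LaurentPolynomial.T 1 : ℤ[T;T⁻¹]) • c (.inl (p.1, true)) +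
      (LaurentPolynomial.T 1 : ℤ[T;T⁻¹]) • c (.inl (D.next.symm p)) = c (.inl p)
  else
    (1 - LaurentPolynomial.T 1 : ℤ[T;T⁻¹]) • c (.inl (p.1, true)) +
      (LaurentPolynomial.T 1 : ℤ[T;T⁻¹]) • c (.inl p) = c (.inl (D.next.symm p))

/-- Alexander colorings of a diagram: solutions of the relations at all passages. -/
def IsColoring : FamilyProp ℤ[T;T⁻¹] D.Gen := fun _ _ _ c => ∀ p, D.PassageRel c p

theorem sum_outEdge_smul {X : Type} [AddCommGroup X] [Module ℤ[T;T⁻¹] X] (c : D.Gen → X)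
    (p : D.Passage) : ∑ g, D.outEdge p g • c g = c (.inl p) := by
  simp [outEdge, Pi.single_apply, ite_smul]

theorem isSolution_alexanderMatrix_iff (X : Type) [AddCommGroup X] [Module ℤ[T;T⁻¹] X]
    (c : D.Gen → X) : IsSolution D.alexanderMatrix X c ↔ D.IsColoring X c := by
  refine forall_congr' fun p => ?_
  simp only [alexanderMatrix, Matrix.of_apply, PassageRel, inEdge]
  split_ifs <;>
    simp only [Pi.sub_apply, Pi.add_apply, Pi.smul_apply, sub_smul (M := X), add_smul (M := X),
      smul_assoc, Finset.sum_add_distrib, Finset.sum_sub_distrib, ← Finset.smul_sum,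
      sum_outEdge_smul, sub_eq_zero]

theorem isAlexanderPolynomial_congr {D D' : GaussDiagram} [Nonempty D.Gen] [Nonempty D'.Gen]
    (h : SolEquiv D.IsColoring D'.IsColoring) (Δ : ℤ[T;T⁻¹]) :
    D.IsAlexanderPolynomial Δ ↔ D'.IsAlexanderPolynomial Δ := by
  have := ((SolEquiv.of_iff D.isSolution_alexanderMatrix_iff).trans h).trans
    (SolEquiv.of_iff D'.isSolution_alexanderMatrix_iff).symm
  rw [isAlexanderPolynomial_iff_minorIdeal, isAlexanderPolynomial_iff_minorIdeal,
    this.minorIdeal_eq]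

end GaussDiagram

/-! ### Forgetting crossings -/

/-- An injection into a set with `n` more elements, as the inclusion of a summand. -/
theorem exists_equiv_sum_fin {A B : Type*} [Finite B] {f : A → B} (hf : Function.Injective f)
    {n : ℕ} (h : Nat.card B = Nat.card A + n) :
    ∃ e : B ≃ A ⊕ Fin n, ∀ a, e (f a) = Sum.inl a := by
  classical
  have := Finite.of_injective f hf
  have h1 : Nat.card B = Nat.card A + Nat.card ((Set.range f)ᶜ : Set B) := by
    rw [Nat.card_congr (Equiv.ofInjective f hf), ← Nat.card_sum,
      Nat.card_congr (Equiv.Set.sumCompl (Set.range f))]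
  obtain ⟨e⟩ : Nonempty (((Set.range f)ᶜ : Set B) ≃ Fin n) :=
    ⟨Finite.equivFinOfCardEq (by omega)⟩
  refine ⟨(Equiv.Set.sumCompl (Set.range f)).symm.trans
    (Equiv.sumCongr (Equiv.ofInjective f hf).symm e), fun a => ?_⟩
  rw [Equiv.trans_apply, Equiv.Set.sumCompl_symm_apply_of_mem (Set.mem_range_self a)]
  simp only [Equiv.sumCongr_apply, Sum.map_inl]
  congr 1
  exact Equiv.ofInjective_symm_apply hf a

namespace GaussDiagram

/-- Colorings for which the crossings in `S` are disregarded: their passages do not change the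
color. -/
def IsReducedColoring (D : GaussDiagram) (S : Set (Fin D.numCrossings)) :
    FamilyProp ℤ[T;T⁻¹] D.Gen :=
  fun _ _ _ c => ∀ p : D.Passage, (p.1 ∈ S → c (.inl p) = c (.inl (D.next.symm p))) ∧
    (p.1 ∉ S → D.PassageRel c p)

section Forget

variable {D D' : GaussDiagram} {S : Set (Fin D.numCrossings)}
  {φ : Fin D'.numCrossings ↪ Fin D.numCrossings}

/-- The passage of the larger diagram that corresponds to a passage of the smaller one. -/
def liftPassage (φ : Fin D'.numCrossings ↪ Fin D.numCrossings) (q : D'.Passage) : D.Passage :=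
  (φ q.1, q.2)

theorem liftPassage_injective (φ : Fin D'.numCrossings ↪ Fin D.numCrossings) :
    Function.Injective (liftPassage φ) := by
  intro p q h
  exact Prod.ext (φ.injective (congrArg (fun x : D.Passage => x.1) h))
    (congrArg (fun x : D.Passage => x.2) h)

theorem liftPassage_notMem (hφ : Set.range φ = Sᶜ) (q : D'.Passage) : (liftPassage φ q).1 ∉ S := by
  have : φ q.1 ∈ Sᶜ := hφ ▸ Set.mem_range_self _
  exact this

theorem exists_liftPassage (hφ : Set.range φ = Sᶜ) {p : D.Passage} (hp : p.1 ∉ S) :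
    ∃ q : D'.Passage, liftPassage φ q = p := by
  obtain ⟨y, hy⟩ : p.1 ∈ Set.range φ := hφ ▸ hp
  exact ⟨(y, p.2), Prod.ext hy rfl⟩

variable (S) in
/-- Arcs of a diagram some of whose crossings are disregarded. -/
abbrev Arc : Type := Quot fun p q : D.Passage => D.next p = q ∧ q.1 ∈ S

/-- Components with crossings of a diagram. -/
abbrev Cycle (D : GaussDiagram) : Type := Quot fun p q : D.Passage => D.next p = q

/-- The set of passages of the arc that starts at `q`. -/
def arcSet (S : Set (Fin D.numCrossings)) (φ : Fin D'.numCrossings ↪ Fin D.numCrossings)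
    (q : D'.Passage) : Set D.Passage :=
  {p | ∃ j : ℕ, (∀ i, 1 ≤ i → i ≤ j → ((D.next ^ i) (liftPassage φ q)).1 ∈ S) ∧
    (D.next ^ j) (liftPassage φ q) = p}

theorem mk_pow_next {S : Set (Fin D.numCrossings)} (p : D.Passage) (j : ℕ)
    (h : ∀ i, 1 ≤ i → i ≤ j → ((D.next ^ i) p).1 ∈ S) :
    (Quot.mk _ ((D.next ^ j) p) : Arc S) = Quot.mk _ p := by
  induction j with
  | zero => rfl
  | succ j ih =>
    rw [← ih fun i h1 h2 => h i h1 (by omega)]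
    refine (Quot.sound ⟨?_, h (j + 1) (by omega) le_rfl⟩).symm
    rw [pow_succ', Equiv.Perm.mul_apply]

theorem mk_eq_of_mem_arcSet {q : D'.Passage} {p : D.Passage} (h : p ∈ arcSet S φ q) :
    (Quot.mk _ p : Arc S) = Quot.mk _ (liftPassage φ q) := by
  obtain ⟨j, hj, rfl⟩ := h
  exact mk_pow_next _ _ hj

theorem self_mem_arcSet (q : D'.Passage) : liftPassage φ q ∈ arcSet S φ q :=
  ⟨0, fun i h1 h2 => by omega, rfl⟩

theorem eq_of_mem_arcSet {q : D'.Passage} {p : D.Passage} (h : p ∈ arcSet S φ q) (hp : p.1 ∉ S) :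
    p = liftPassage φ q := by
  obtain ⟨j, hj, rfl⟩ := h
  rcases j.eq_zero_or_pos with rfl | h0
  · rfl
  · exact absurd (hj j h0 le_rfl) hp

theorem mem_arcSet_next_iff (hφ : Set.range φ = Sᶜ) (q : D'.Passage) {p : D.Passage}
    (hp : (D.next p).1 ∈ S) : D.next p ∈ arcSet S φ q ↔ p ∈ arcSet S φ q := by
  constructor
  · rintro ⟨j, hj, h⟩
    rcases j.eq_zero_or_pos with rfl | h0
    · rw [pow_zero, Equiv.Perm.one_apply] at h
      exact absurd (h ▸ hp) (liftPassage_notMem hφ q)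
    · obtain ⟨j, rfl⟩ : ∃ i, j = i + 1 := ⟨j - 1, by omega⟩
      rw [pow_succ', Equiv.Perm.mul_apply] at h
      exact ⟨j, fun i h1 h2 => hj i h1 (by omega), D.next.injective h⟩
  · rintro ⟨j, hj, rfl⟩
    have h : (D.next ^ (j + 1)) (liftPassage φ q) = D.next ((D.next ^ j) (liftPassage φ q)) := by
      rw [pow_succ', Equiv.Perm.mul_apply]
    refine ⟨j + 1, fun i h1 h2 => ?_, h⟩
    rcases h2.lt_or_eq with h2 | rfl
    · exact hj i h1 (by omega)
    · rw [h]; exact hp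

variable (S φ) in
/-- The passage after `q` in the smaller diagram is the first one after `q` in the larger diagram
at a crossing outside `S`. -/
def FirstReturn : Prop := ∀ p : D'.Passage, ∃ k : ℕ,
  (∀ j, 1 ≤ j → j ≤ k → ((D.next ^ j) (φ p.1, p.2)).1 ∈ S) ∧
    (D.next ^ (k + 1)) (φ p.1, p.2) = (φ (D'.next p).1, (D'.next p).2)

theorem arc_injective (hφ : Set.range φ = Sᶜ) :
    Function.Injective fun q : D'.Passage => (Quot.mk _ (liftPassage φ q) : Arc S) := by
  intro q q' h
  let f : Arc S → Prop := Quot.lift (fun p => p ∈ arcSet S φ q) (by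
    rintro p _ ⟨rfl, hp⟩
    exact propext (mem_arcSet_next_iff hφ q hp).symm)
  have h1 : f (Quot.mk _ (liftPassage φ q)) := self_mem_arcSet q
  have h2 : liftPassage φ q' ∈ arcSet S φ q := by
    dsimp only at h
    rw [h] at h1
    exact h1
  exact (liftPassage_injective φ (eq_of_mem_arcSet h2 (liftPassage_notMem hφ q'))).symm

theorem symm_next_mem_arcSet (hret : FirstReturn S φ) (q : D'.Passage) :
    D.next.symm (liftPassage φ (D'.next q)) ∈ arcSet S φ q := by
  obtain ⟨k, hk, h⟩ := hret q
  refine ⟨k, hk, ?_⟩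
  rw [Equiv.eq_symm_apply, ← Equiv.Perm.mul_apply, ← pow_succ']
  exact h

theorem mem_arcSet_next (hφ : Set.range φ = Sᶜ) (hret : FirstReturn S φ) (q : D'.Passage)
    {p : D.Passage} (hp : (D.next p).1 ∉ S) (h : p ∈ arcSet S φ q) : D.next p = liftPassage φ (D'.next q) := by
  obtain ⟨k, hk, hk'⟩ := hret q
  obtain ⟨j, hj, rfl⟩ := h
  rw [← Equiv.Perm.mul_apply, ← pow_succ'] at hp ⊢
  have : j = k := by
    rcases lt_trichotomy j k with h | h | h
    · exact absurd (hk (j + 1) (by omega) h) hp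
    · exact h
    · have := hj (k + 1) (by omega) h
      rw [liftPassage, hk'] at this
      exact absurd this (liftPassage_notMem hφ (D'.next q))
  subst this
  exact hk'

/-- A component of the smaller diagram is contained in a component of the larger one. -/
theorem cycle_lift (hret : FirstReturn S φ) (q q' : D'.Passage) (h : D'.next q = q') :
    (Quot.mk _ (liftPassage φ q) : D.Cycle) = Quot.mk _ (liftPassage φ q') := by
  subst h
  obtain ⟨k, -, h⟩ := hret q
  have : ∀ j : ℕ, (Quot.mk _ (liftPassage φ q) : D.Cycle) =
      Quot.mk _ ((D.next ^ j) (liftPassage φ q)) := by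
    intro j
    induction j with
    | zero => rfl
    | succ j ih =>
      rw [ih]
      refine Quot.sound ?_
      rw [pow_succ', Equiv.Perm.mul_apply]
  rw [this (k + 1)]
  exact congrArg _ h

theorem cycle_injective (hφ : Set.range φ = Sᶜ) (hret : FirstReturn S φ) : Function.Injective
    (Quot.lift (fun q => (Quot.mk _ (liftPassage φ q) : D.Cycle)) (cycle_lift hret) :
      D'.Cycle → D.Cycle) := by
  intro z z' h
  induction z using Quot.ind with | mk q => ?_
  induction z' using Quot.ind with | mk q' => ?_
  let f : D.Cycle → Prop := Quot.lift
    (fun p => ∃ r : D'.Passage, (Quot.mk _ r : D'.Cycle) = Quot.mk _ q ∧ p ∈ arcSet S φ r) (by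
      rintro p _ rfl
      refine propext ⟨?_, ?_⟩
      · rintro ⟨r, hr, hp⟩
        by_cases hS : (D.next p).1 ∈ S
        · exact ⟨r, hr, (mem_arcSet_next_iff hφ r hS).2 hp⟩
        · refine ⟨D'.next r, (Quot.sound (r := fun p q => D'.next p = q) rfl).symm.trans hr, ?_⟩
          rw [mem_arcSet_next hφ hret r hS hp]
          exact self_mem_arcSet _
      · rintro ⟨r, hr, hp⟩
        by_cases hS : (D.next p).1 ∈ S
        · exact ⟨r, hr, (mem_arcSet_next_iff hφ r hS).1 hp⟩
        · refine ⟨D'.next.symm r, (Quot.sound (by simp)).trans hr, ?_⟩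
          have := symm_next_mem_arcSet hret (D'.next.symm r)
          rwa [Equiv.apply_symm_apply, ← eq_of_mem_arcSet hp hS, Equiv.symm_apply_apply] at this)
  have h1 : f (Quot.mk _ (liftPassage φ q)) := ⟨q, rfl, self_mem_arcSet q⟩
  have h2 : f (Quot.mk _ (liftPassage φ q')) := by
    change (Quot.mk _ (liftPassage φ q) : D.Cycle) = Quot.mk _ (liftPassage φ q') at h
    rw [← h]; exact h1
  obtain ⟨r, hr, hr'⟩ := h2
  rw [← liftPassage_injective φ (eq_of_mem_arcSet hr' (liftPassage_notMem hφ q'))] at hr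
  exact hr.symm

/-- The arcs without a remaining crossing are the components all of whose crossings have been
forgotten. -/
theorem card_arc (hφ : Set.range φ = Sᶜ) (hret : FirstReturn S φ) :
    Nat.card (Arc S) + Nat.card D'.Cycle = Nat.card D'.Passage + Nat.card D.Cycle := by
  classical
  have hcl := cycle_lift hret
  set f : D'.Passage → Arc S := fun q => Quot.mk _ (liftPassage φ q) with hf
  set g : D'.Cycle → D.Cycle := Quot.lift (fun q => Quot.mk _ (liftPassage φ q)) hcl with hg
  let π : Arc S → D.Cycle := Quot.map id fun p q h => h.1
  have hπ (q : D'.Passage) : π (f q) = g (Quot.mk _ q) := rfl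
  have hmem (p : D.Passage) (h : (Quot.mk _ p : D.Cycle) ∉ Set.range g) : p.1 ∈ S := by
    by_contra hp
    obtain ⟨q, rfl⟩ := exists_liftPassage hφ hp
    exact h ⟨Quot.mk _ q, rfl⟩
  have hrange (a : Arc S) : π a ∉ Set.range g ↔ a ∉ Set.range f := by
    refine not_congr ⟨?_, ?_⟩
    · rintro ⟨z, hz⟩
      induction z using Quot.ind with | mk q => ?_
      induction a using Quot.ind with | mk p => ?_
      let F : D.Cycle → Prop := Quot.lift (fun p => ∃ r : D'.Passage, p ∈ arcSet S φ r) (by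
        rintro p _ rfl
        refine propext ⟨?_, ?_⟩
        · rintro ⟨r, hp⟩
          by_cases hS : (D.next p).1 ∈ S
          · exact ⟨r, (mem_arcSet_next_iff hφ r hS).2 hp⟩
          · obtain ⟨r', hr'⟩ := exists_liftPassage hφ hS
            exact ⟨r', hr' ▸ self_mem_arcSet _⟩
        · rintro ⟨r, hp⟩
          by_cases hS : (D.next p).1 ∈ S
          · exact ⟨r, (mem_arcSet_next_iff hφ r hS).1 hp⟩
          · refine ⟨D'.next.symm r, ?_⟩
            have := symm_next_mem_arcSet hret (D'.next.symm r)
            rwa [Equiv.apply_symm_apply, ← eq_of_mem_arcSet hp hS, Equiv.symm_apply_apply] at this)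
      have h1 : F (Quot.mk _ (liftPassage φ q)) := ⟨q, self_mem_arcSet q⟩
      have h2 : F (Quot.mk _ p) := by
        change (Quot.mk _ (liftPassage φ q) : D.Cycle) = Quot.mk _ p at hz
        rw [← hz]; exact h1
      obtain ⟨r, hr⟩ := h2
      exact ⟨r, (mk_eq_of_mem_arcSet hr).symm⟩
    · rintro ⟨q, rfl⟩
      exact ⟨Quot.mk _ q, rfl⟩
  have hinj (p q : D.Passage) (h : (Quot.mk _ p : D.Cycle) = Quot.mk _ q)
      (hp : (Quot.mk _ p : D.Cycle) ∉ Set.range g) :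
      (Quot.mk _ p : Arc S) = Quot.mk _ q := by
    have h' := Quot.eqvGen_exact h
    clear h
    induction h' with
    | rel p q h =>
      exact Quot.sound ⟨h, hmem q (by rwa [← Quot.sound (r := fun p q => D.next p = q) h])⟩
    | refl => rfl
    | symm p q hpq ih => exact (ih (by rwa [Quot.eqvGen_sound hpq])).symm
    | trans p q r hpq _ ih1 ih2 =>
      exact (ih1 hp).trans (ih2 (by rwa [← Quot.eqvGen_sound hpq]))
  have e : ((Set.range f)ᶜ : Set (Arc S)) ≃ ((Set.range g)ᶜ : Set D.Cycle) :=
    Equiv.ofBijective (fun a => ⟨π a.1, (hrange a.1).2 a.2⟩) (by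
      constructor
      · rintro ⟨a, ha⟩ ⟨b, hb⟩ h
        induction a using Quot.ind with | mk p => ?_
        induction b using Quot.ind with | mk q => ?_
        exact Subtype.ext (hinj p q (congrArg Subtype.val h) ((hrange _).2 ha))
      · rintro ⟨z, hz⟩
        induction z using Quot.ind with | mk p => ?_
        exact ⟨⟨Quot.mk _ p, (hrange _).1 hz⟩, rfl⟩)
  have h1 : Nat.card (Arc S) = Nat.card D'.Passage + Nat.card ((Set.range f)ᶜ : Set (Arc S)) := by
    rw [Nat.card_congr (Equiv.ofInjective f (arc_injective hφ)), ← Nat.card_sum,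
      Nat.card_congr (Equiv.Set.sumCompl (Set.range f))]
  have h2 : Nat.card D.Cycle = Nat.card D'.Cycle + Nat.card ((Set.range g)ᶜ : Set D.Cycle) := by
    rw [Nat.card_congr (Equiv.ofInjective g (cycle_injective hφ hret)), ← Nat.card_sum,
      Nat.card_congr (Equiv.Set.sumCompl (Set.range g))]
  rw [h1, h2, Nat.card_congr e]
  omega

theorem Forgets.solEquiv (h : D.Forgets D' S) :
    SolEquiv (D.IsReducedColoring S) D'.IsColoring := by
  obtain ⟨φ, hφ, hsign, hret, hcomp⟩ := h
  have hcard := card_arc hφ hret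
  obtain ⟨e, he⟩ := exists_equiv_sum_fin (A := D'.Passage) (B := Arc S ⊕ Fin D.numCircles)
    (f := fun q => Sum.inl (Quot.mk _ (liftPassage φ q)))
    (Sum.inl_injective.comp (arc_injective hφ)) (n := D'.numCircles) (by
      rw [Nat.card_sum, Nat.card_fin]
      have : D'.numCircles + Nat.card D'.Cycle = D.numCircles + Nat.card D.Cycle := hcomp
      omega)
  let σ : D.Gen → D'.Gen := fun g => e (Sum.map (Quot.mk _) id g)
  have hσ : Function.Surjective σ :=
    e.surjective.comp (Sum.map_surjective.2 ⟨Quot.mk_surjective, Function.surjective_id⟩)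
  have hσΦ (q : D'.Passage) : σ (.inl (liftPassage φ q)) = .inl q := he q
  have hσS (p : D.Passage) (hp : p.1 ∈ S) : σ (.inl p) = σ (.inl (D.next.symm p)) := by
    have : (Quot.mk _ p : Arc S) = Quot.mk _ (D.next.symm p) :=
      (Quot.sound ⟨by simp, hp⟩).symm
    simp only [σ, Sum.map_inl, this]
  have hσn (q : D'.Passage) : σ (.inl (D.next.symm (liftPassage φ q))) =
      .inl (D'.next.symm q) := by
    have h := symm_next_mem_arcSet hret (D'.next.symm q)
    rw [Equiv.apply_symm_apply] at h
    rw [← hσΦ]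
    simp only [σ, Sum.map_inl, mk_eq_of_mem_arcSet h]
  -- colorings that disregard `S` are constant along the arcs
  have hconst (X : Type) [AddCommGroup X] [Module ℤ[T;T⁻¹] X] (c : D.Gen → X)
      (hc : D.IsReducedColoring S X c) (g g' : D.Gen) (h : σ g = σ g') : c g = c g' := by
    have h := e.injective h
    rcases g with p | i <;> rcases g' with p' | i' <;>
      clear * - h hc <;>
      simp only [Sum.map_inl, Sum.map_inr, Sum.inl.injEq, Sum.inr.injEq, reduceCtorEq, id] at h
    · have h' := Quot.eqvGen_exact h
      clear h
      induction h' with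
      | rel p q h =>
        obtain ⟨rfl, hq⟩ := h
        have := (hc (D.next p)).1 hq
        rw [this, Equiv.symm_apply_apply]
      | refl => rfl
      | symm _ _ _ ih => exact ih.symm
      | trans _ _ _ _ _ ih1 ih2 => exact ih1.trans ih2
    · rw [h]
  have hrel (X : Type) [AddCommGroup X] [Module ℤ[T;T⁻¹] X] (c : D'.Gen → X) (q : D'.Passage) :
      D.PassageRel (c ∘ σ) (liftPassage φ q) ↔ D'.PassageRel c q := by
    have h : σ (.inl ((liftPassage φ q).1, true)) = .inl (q.1, true) := hσΦ (q.1, true)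
    simp only [PassageRel, Function.comp_apply, h, hσn, hσΦ, hsign]
    rfl
  have hcol (X : Type) [AddCommGroup X] [Module ℤ[T;T⁻¹] X] (c : D'.Gen → X) :
      D.IsReducedColoring S X (c ∘ σ) ↔ D'.IsColoring X c := by
    constructor
    · intro h q
      exact (hrel X c q).1 ((h _).2 (liftPassage_notMem hφ q))
    · intro h p
      refine ⟨fun hp => congrArg c (hσS p hp), fun hp => ?_⟩
      obtain ⟨q, rfl⟩ := exists_liftPassage hφ hp
      exact (hrel X c q).2 (h q)
  refine ⟨fun X _ _ c => c ∘ Function.surjInv hσ, fun X _ _ c => c ∘ σ, ?_, ?_, ?_, ?_⟩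
  · intro X _ _ c hc
    have h : (c ∘ Function.surjInv hσ) ∘ σ = c :=
      funext fun g => hconst X c hc _ _ (Function.surjInv_eq hσ _)
    exact ⟨(hcol X _).1 (by rwa [h]), h⟩
  · intro X _ _ c hc
    exact ⟨(hcol X c).2 hc, funext fun g => congrArg c (Function.surjInv_eq hσ g)⟩
  · exact fun _ _ _ _ _ _ _ _ => rfl
  · exact fun _ _ _ _ _ _ _ _ => rfl

end Forget

end GaussDiagram

/-! ### Invariance under Reidemeister moves -/

section Act

variable {X : Type} [AddCommGroup X] [Module ℤ[T;T⁻¹] X]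

/-- The action of the color `a` of an over-strand on the color `b` of an under-strand, at a
crossing of sign `s` (the Alexander quandle operation and its inverse). -/
def act (s : ℤˣ) (a b : X) : X := a + (LaurentPolynomial.T (s : ℤ) : ℤ[T;T⁻¹]) • (b - a)

theorem act_neg_act (s : ℤˣ) (a b : X) : act (-s) a (act s a b) = b := by
  simp only [act, add_sub_cancel_left, smul_smul, ← LaurentPolynomial.T_add]
  simp

theorem act_act_neg (s : ℤˣ) (a b : X) : act s a (act (-s) a b) = b := by
  simpa using act_neg_act (-s) a b

theorem eq_act_iff {s : ℤˣ} {a b c : X} : c = act s a b ↔ b = act (-s) a c :=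
  ⟨fun h => by rw [h, act_neg_act], fun h => by rw [h, act_act_neg]⟩

@[simp] theorem act_self (s : ℤˣ) (a : X) : act s a a = a := by simp [act]

theorem act_act (s r : ℤˣ) (a b c : X) :
    act s a (act r b c) = act r (act s a b) (act s a c) := by
  simp only [act]
  module

theorem map_act {Y : Type} [AddCommGroup Y] [Module ℤ[T;T⁻¹] Y] (f : X →ₗ[ℤ[T;T⁻¹]] Y)
    (s : ℤˣ) (a b : X) : f (act s a b) = act s (f a) (f b) := by
  simp [act]

end Act

namespace GaussDiagram

section Moves

variable {D : GaussDiagram} {X : Type} [AddCommGroup X] [Module ℤ[T;T⁻¹] X]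

theorem passageRel_over (c : D.Gen → X) (x : Fin D.numCrossings) :
    D.PassageRel c (x, true) ↔ c (.inl (x, true)) = c (.inl (D.next.symm (x, true))) := by
  simp [PassageRel]

theorem passageRel_under (c : D.Gen → X) (x : Fin D.numCrossings) :
    D.PassageRel c (x, false) ↔ c (.inl (x, false)) =
      act (D.sign x) (c (.inl (x, true))) (c (.inl (D.next.symm (x, false)))) := by
  have key (a b : X) : (1 - LaurentPolynomial.T 1 : ℤ[T;T⁻¹]) • a +
      (LaurentPolynomial.T 1 : ℤ[T;T⁻¹]) • b = act 1 a b := by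
    simp only [act, Units.val_one]
    module
  simp only [PassageRel, key, Bool.false_eq_true, if_false]
  rcases Int.units_eq_one_or (D.sign x) with h | h <;> rw [h]
  · simp [eq_comm]
  · rw [if_neg (by decide), eq_act_iff, neg_neg, eq_comm]

theorem isReducedColoring_singleton_iff {x : Fin D.numCrossings} {b : Bool}
    (hx : D.next (x, b) = (x, !b)) (c : D.Gen → X) :
    D.IsColoring X c ↔ D.IsReducedColoring {x} X c := by
  have hx' : D.next.symm (x, !b) = (x, b) := by rw [← hx, Equiv.symm_apply_apply]
  have key : (D.PassageRel c (x, true) ∧ D.PassageRel c (x, false)) ↔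
      (c (.inl (x, true)) = c (.inl (D.next.symm (x, true))) ∧
        c (.inl (x, false)) = c (.inl (D.next.symm (x, false)))) := by
    rw [passageRel_over, passageRel_under]
    refine and_congr_right fun h => ?_
    cases b
    · simp only [Bool.not_false] at hx'
      rw [hx'] at h
      rw [h, eq_act_iff, act_self, eq_comm]
    · simp only [Bool.not_true] at hx'
      rw [hx', act_self]
  constructor
  · intro h p
    refine ⟨fun hp => ?_, fun _ => h p⟩
    obtain ⟨y, v⟩ := p
    obtain rfl : y = x := hp
    have := key.1 ⟨h _, h _⟩
    cases v
    exacts [this.2, this.1]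
  · intro h p
    by_cases hp : p.1 = x
    · obtain ⟨y, v⟩ := p
      obtain rfl : y = x := hp
      have := key.2 ⟨(h (y, true)).1 rfl, (h (y, false)).1 rfl⟩
      cases v
      exacts [this.2, this.1]
    · exact (h p).2 hp

theorem passageRel_congr {c c' : D.Gen → X} {p : D.Passage} (h1 : c (.inl p) = c' (.inl p))
    (h2 : c (.inl (D.next.symm p)) = c' (.inl (D.next.symm p)))
    (h3 : c (.inl (p.1, true)) = c' (.inl (p.1, true))) :
    D.PassageRel c p ↔ D.PassageRel c' p := by
  simp only [PassageRel, h1, h2, h3]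

/-- Two consecutive under-passages of opposite signs below the same strand can be forgotten: only
the color of the edge between them changes. -/
theorem solEquiv_isReducedColoring_pair {u v : Fin D.numCrossings} (huv : u ≠ v)
    (hsign : D.sign v = -D.sign u)
    (hover : D.next (u, true) = (v, true) ∨ D.next (v, true) = (u, true))
    (hunder : D.next (u, false) = (v, false)) :
    SolEquiv D.IsColoring (D.IsReducedColoring {u, v}) := by
  have hu : D.next.symm (v, false) = (u, false) := by rw [← hunder, Equiv.symm_apply_apply]
  have hne : D.next.symm (u, false) ≠ (u, false) := by
    rw [Ne, Equiv.symm_apply_eq, hunder]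
    simpa using huv
  have hover' {X : Type} [AddCommGroup X] [Module ℤ[T;T⁻¹] X] {c : D.Gen → X}
      (h1 : c (.inl (u, true)) = c (.inl (D.next.symm (u, true))))
      (h2 : c (.inl (v, true)) = c (.inl (D.next.symm (v, true)))) :
      c (.inl (v, true)) = c (.inl (u, true)) := by
    rcases hover with h | h
    · rw [h2, ← h, Equiv.symm_apply_apply]
    · rw [h1, ← h, Equiv.symm_apply_apply]
  have hext {X : Type} {c : D.Gen → X} {a : X} {p : D.Passage} (h : p ≠ (u, false)) :
      Function.update c (.inl (u, false)) a (.inl p) = c (.inl p) :=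
    Function.update_of_ne (by simpa using h) _ _
  have hrel {X : Type} [AddCommGroup X] [Module ℤ[T;T⁻¹] X] {c : D.Gen → X} {a : X}
      {p : D.Passage} (h1 : p ≠ (u, false)) (h2 : p ≠ (v, false)) :
      D.PassageRel (Function.update c (.inl (u, false)) a) p ↔ D.PassageRel c p := by
    refine passageRel_congr (hext h1) (hext ?_) (hext (by simp))
    rw [Ne, Equiv.symm_apply_eq, hunder]
    exact h2
  refine ⟨fun X _ _ c => Function.update c (.inl (u, false)) (c (.inl (D.next.symm (u, false)))),
    fun X _ _ c => Function.update c (.inl (u, false))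
      (act (D.sign u) (c (.inl (u, true))) (c (.inl (D.next.symm (u, false))))), ?_, ?_, ?_, ?_⟩
  · intro X _ _ c hc
    dsimp only
    have c1 := (passageRel_over _ _).1 (hc (u, true))
    have c2 := (passageRel_over _ _).1 (hc (v, true))
    have c3 := (passageRel_under _ _).1 (hc (u, false))
    have c4 := (passageRel_under _ _).1 (hc (v, false))
    rw [hu, hsign, hover' c1 c2, c3, act_neg_act] at c4
    refine ⟨fun p => ⟨?_, fun hp => ?_⟩, ?_⟩
    · rintro (hp | hp)
      · obtain ⟨y, w⟩ := p
        obtain rfl : y = u := hp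
        cases w
        · rw [Function.update_self, hext hne]
        · exact (passageRel_over _ _).1 ((hrel (by simp) (by simp)).2 (hc _))
      · obtain ⟨y, w⟩ := p
        obtain rfl : y = v := hp
        cases w
        · rw [hu, Function.update_self, hext (by simpa using huv.symm), c4]
        · exact (passageRel_over _ _).1 ((hrel (by simp) (by simp)).2 (hc _))
    · refine (hrel ?_ ?_).2 (hc p) <;> rintro rfl <;> simp at hp
    · rw [hext (by simp), hext hne, ← c3, Function.update_idem, Function.update_eq_self]
  · intro X _ _ c hc
    dsimp only
    have c1 := (hc (u, true)).1 (by simp)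
    have c2 := (hc (v, true)).1 (by simp)
    have c3 := (hc (u, false)).1 (by simp)
    have c4 := (hc (v, false)).1 (by simp)
    rw [hu] at c4
    refine ⟨fun p => ?_, ?_⟩
    · by_cases h1 : p = (u, false)
      · rw [h1, passageRel_under, Function.update_self, hext (by simp), hext hne]
      by_cases h2 : p = (v, false)
      · rw [h2, passageRel_under, hu, Function.update_self, hext (by simpa using huv.symm),
          hext (by simp), hover' c1 c2, hsign, act_neg_act, c4, c3]
      rw [hrel h1 h2]
      by_cases hp : p.1 ∈ ({u, v} : Set (Fin D.numCrossings))
      · obtain ⟨y, w⟩ := p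
        cases w
        · rcases hp with rfl | rfl <;> simp at h1 h2
        · exact (passageRel_over _ _).2 ((hc _).1 hp)
      · exact (hc p).2 hp
    · rw [hext hne, Function.update_idem, ← c3, Function.update_eq_self]
  · intro X Y _ _ _ _ f c
    rw [Function.comp_update]; rfl
  · intro X Y _ _ _ _ f c
    rw [Function.comp_update, map_act]; rfl

theorem solEquiv_of_bigon {x y : Fin D.numCrossings} (hxy : x ≠ y)
    (hsign : D.sign y = -D.sign x) (hover : D.next (x, true) = (y, true))
    (hunder : D.next (x, false) = (y, false) ∨ D.next (y, false) = (x, false)) :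
    SolEquiv D.IsColoring (D.IsReducedColoring {x, y}) := by
  rcases hunder with h | h
  · exact solEquiv_isReducedColoring_pair hxy hsign (.inl hover) h
  · rw [Set.pair_comm]
    exact solEquiv_isReducedColoring_pair hxy.symm (by rw [hsign, neg_neg]) (.inr hover) h

theorem isReducedColoring_empty_iff (c : D.Gen → X) :
    D.IsColoring X c ↔ D.IsReducedColoring ∅ X c := by
  simp [IsColoring, IsReducedColoring]

end Moves

end GaussDiagram

/-! ### Moving a strand across a triangle -/

namespace GaussDiagram

section Recolor

variable {D : GaussDiagram} {X : Type}

/-- The colors of the two inner edges of the middle and the bottom strand of a triangle are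
changed. -/
def recolor (e e' : D.Passage) (m b : X) (κ : D.Passage → X) : D.Passage → X :=
  Function.update (Function.update κ e m) e' b

theorem recolor_fst {e e' : D.Passage} (h : e ≠ e') (m b : X) (κ : D.Passage → X) :
    recolor e e' m b κ e = m := by
  rw [recolor, Function.update_of_ne h, Function.update_self]

theorem recolor_snd (e e' : D.Passage) (m b : X) (κ : D.Passage → X) :
    recolor e e' m b κ e' = b := Function.update_self ..

theorem recolor_of_ne {e e' p : D.Passage} (h : p ≠ e) (h' : p ≠ e') (m b : X)
    (κ : D.Passage → X) : recolor e e' m b κ p = κ p := by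
  rw [recolor, Function.update_of_ne h', Function.update_of_ne h]

theorem recolor_recolor {e e' : D.Passage} (h : e ≠ e') (m b m' b' : X) (κ : D.Passage → X) :
    recolor e e' m' b' (recolor e e' m b κ) = recolor e e' m' b' κ := by
  rw [recolor, recolor, Function.update_comm h, Function.update_idem, Function.update_comm h.symm,
    Function.update_idem, recolor]

theorem recolor_eq_self {e e' : D.Passage} {m b : X} {κ : D.Passage → X} (h : κ e = m)
    (h' : κ e' = b) : recolor e e' m b κ = κ := by
  rw [recolor, ← h, ← h', Function.update_eq_self, Function.update_eq_self]

end Recolor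

section Triangle

variable {D : GaussDiagram} {X : Type} [AddCommGroup X] [Module ℤ[T;T⁻¹] X]

/-- The edge met after the passage `p` when travelling in the direction `a` along the strand. -/
def dirEdge (D : GaussDiagram) (a : ℤˣ) (p : D.Passage) : D.Passage :=
  if a = 1 then p else D.next.symm p

theorem dirEdge_one (p : D.Passage) : D.dirEdge 1 p = p := if_pos rfl

theorem dirEdge_neg_one (p : D.Passage) : D.dirEdge (-1) p = D.next.symm p :=
  if_neg (by decide)

theorem dirEdge_injective (a : ℤˣ) : Function.Injective (D.dirEdge a) := by
  rcases Int.units_eq_one_or a with rfl | rfl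
  · exact fun p q h => by simpa only [dirEdge_one] using h
  · exact fun p q h => D.next.symm.injective (by simpa only [dirEdge_neg_one] using h)

theorem Consecutive.dirEdge_eq {a : ℤˣ} {p q : D.Passage} (h : D.Consecutive a p q) :
    D.dirEdge (-a) q = D.dirEdge a p := by
  rcases h with ⟨rfl, h⟩ | ⟨rfl, h⟩
  · rw [dirEdge_one, dirEdge_neg_one, Equiv.symm_apply_eq, h]
  · rw [neg_neg, dirEdge_one, dirEdge_neg_one, Equiv.eq_symm_apply, h]

theorem Consecutive.dirEdge_ne {a : ℤˣ} {p q : D.Passage} (h : D.Consecutive a p q) {d : ℤˣ}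
    {r : D.Passage} (h1 : ¬ (d = a ∧ r = p)) (h2 : ¬ (d = -a ∧ r = q)) :
    D.dirEdge d r ≠ D.dirEdge a p := by
  intro he
  by_cases hd : d = a
  · subst hd
    exact h1 ⟨rfl, dirEdge_injective _ he⟩
  · have hd' : d = -a := by
      rcases Int.units_eq_one_or d with rfl | rfl <;>
        rcases Int.units_eq_one_or a with rfl | rfl <;> simp at hd ⊢
    subst hd'
    rw [← h.dirEdge_eq] at he
    exact h2 ⟨rfl, dirEdge_injective _ he⟩

/-- The relation that a passage of the crossing `y` imposes at the position of the passage `r`;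
`o` tells whether it is an over-passage, and `w` is the color of the over-strand. -/
def LocalRel (κ : D.Passage → X) (o : Bool) (y : Fin D.numCrossings) (w : X)
    (r : D.Passage) : Prop :=
  if o then κ r = κ (D.next.symm r) else κ r = act (D.sign y) w (κ (D.next.symm r))

theorem localRel_true (d : ℤˣ) {κ : D.Passage → X} {y : Fin D.numCrossings} {w : X}
    {r : D.Passage} : LocalRel κ true y w r ↔ κ (D.dirEdge d r) = κ (D.dirEdge (-d) r) := by
  rcases Int.units_eq_one_or d with rfl | rfl
  · rw [dirEdge_one, dirEdge_neg_one]; rfl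
  · rw [neg_neg, dirEdge_one, dirEdge_neg_one, eq_comm]; rfl

theorem localRel_false (d : ℤˣ) {κ : D.Passage → X} {y : Fin D.numCrossings} {w : X}
    {r : D.Passage} : LocalRel κ false y w r ↔
      κ (D.dirEdge d r) = act (D.sign y * d) w (κ (D.dirEdge (-d) r)) := by
  rcases Int.units_eq_one_or d with rfl | rfl
  · rw [dirEdge_one, dirEdge_neg_one, mul_one]; rfl
  · rw [neg_neg, dirEdge_one, dirEdge_neg_one, eq_act_iff, mul_neg, neg_neg, mul_one]; rfl

/-- The relations of a coloring when the passage `τ r` is made at the position of `r`. -/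
def IsPermutedColoring (τ : Equiv.Perm D.Passage) (κ : D.Passage → X) : Prop :=
  ∀ r, LocalRel κ (τ r).2 (τ r).1 (κ (τ.symm ((τ r).1, true))) r

theorem passageRel_iff_localRel (c : D.Gen → X) (p : D.Passage) :
    D.PassageRel c p ↔ LocalRel (fun q => c (.inl q)) p.2 p.1 (c (.inl (p.1, true))) p := by
  obtain ⟨x, b⟩ := p
  cases b
  · exact passageRel_under c x
  · exact passageRel_over c x

theorem isColoring_iff_isPermutedColoring (c : D.Gen → X) :
    D.IsColoring X c ↔ D.IsPermutedColoring 1 (fun q => c (.inl q)) :=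
  forall_congr' fun p => passageRel_iff_localRel c p

variable {x y z : Fin D.numCrossings}

/-- The permutation of the passages when a strand is moved across a triangle. -/
def slidePerm (x y z : Fin D.numCrossings) : Equiv.Perm D.Passage :=
  Equiv.swap (x, true) (y, true) * Equiv.swap (x, false) (z, true) *
      Equiv.swap (y, false) (z, false)

theorem isColoring_slide_iff (c : (D.slide x y z).Gen → X) :
    (D.slide x y z).IsColoring X c ↔
      D.IsPermutedColoring (slidePerm x y z) (fun q => c (.inl (slidePerm x y z q))) := by
  refine ((slidePerm x y z).forall_congr fun {r} => ?_).symm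
  refine Iff.trans ?_ (passageRel_iff_localRel (D := D.slide x y z) c (slidePerm x y z r)).symm
  have h : (slidePerm x y z * D.next * (slidePerm x y z)⁻¹ : Equiv.Perm D.Passage).symm
      (slidePerm x y z r) = slidePerm x y z (D.next.symm r) := by
    rw [Equiv.symm_apply_eq]
    simp
  have key (q : D.Passage) (hq : q = slidePerm x y z (D.next.symm r)) :
      LocalRel (fun q => c (.inl (slidePerm x y z q))) (slidePerm x y z r).2 (slidePerm x y z r).1
        (c (.inl (slidePerm x y z ((slidePerm x y z).symm ((slidePerm x y z r).1, true))))) r ↔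
      (if (slidePerm x y z r).2 then c (.inl (slidePerm x y z r)) = c (.inl q)
        else c (.inl (slidePerm x y z r)) =
          act (D.sign (slidePerm x y z r).1) (c (.inl ((slidePerm x y z r).1, true)))
            (c (.inl q))) := by
    subst hq
    rw [Equiv.apply_symm_apply]
    rfl
  exact key _ h

/-- It suffices to treat the edges; the circles without crossings keep their colors. -/
theorem solEquiv_slide_of_maps
    (F G : ∀ (X : Type) [AddCommGroup X] [Module ℤ[T;T⁻¹] X], (D.Passage → X) → (D.Passage → X))
    (hF : ∀ (X : Type) [AddCommGroup X] [Module ℤ[T;T⁻¹] X] (κ : D.Passage → X),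
      D.IsPermutedColoring 1 κ →
        D.IsPermutedColoring (slidePerm x y z) (F X κ) ∧ G X (F X κ) = κ)
    (hG : ∀ (X : Type) [AddCommGroup X] [Module ℤ[T;T⁻¹] X] (κ : D.Passage → X),
      D.IsPermutedColoring (slidePerm x y z) κ →
        D.IsPermutedColoring 1 (G X κ) ∧ F X (G X κ) = κ)
    (hF' : ∀ (X Y : Type) [AddCommGroup X] [Module ℤ[T;T⁻¹] X] [AddCommGroup Y]
      [Module ℤ[T;T⁻¹] Y] (f : X →ₗ[ℤ[T;T⁻¹]] Y) (κ : D.Passage → X), F Y (f ∘ κ) = f ∘ F X κ)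
    (hG' : ∀ (X Y : Type) [AddCommGroup X] [Module ℤ[T;T⁻¹] X] [AddCommGroup Y]
      [Module ℤ[T;T⁻¹] Y] (f : X →ₗ[ℤ[T;T⁻¹]] Y) (κ : D.Passage → X), G Y (f ∘ κ) = f ∘ G X κ) :
    SolEquiv D.IsColoring (D.slide x y z).IsColoring := by
  refine ⟨fun X _ _ k => Sum.elim (fun p => F X (fun q => k (.inl q)) ((slidePerm x y z).symm p))
      (fun i => k (.inr i)),
    fun X _ _ k => Sum.elim (G X fun q => k (.inl (slidePerm x y z q))) (fun i => k (.inr i)),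
    ?_, ?_, ?_, ?_⟩
  · intro X _ _ k hk
    obtain ⟨h1, h2⟩ := hF X _ ((isColoring_iff_isPermutedColoring k).1 hk)
    have e : (fun q => F X (fun q => k (.inl q)) ((slidePerm x y z).symm (slidePerm x y z q))) =
        F X (fun q => k (.inl q)) :=
      funext fun q => congrArg _ (Equiv.symm_apply_apply _ q)
    refine ⟨(isColoring_slide_iff _).2 ?_, ?_⟩
    · rw [← e] at h1
      exact h1
    · funext g
      rcases g with p | i
      · rw [← e] at h2
        exact congrFun h2 p
      · rfl
  · intro X _ _ k hk
    obtain ⟨h1, h2⟩ := hG X _ ((isColoring_slide_iff k).1 hk)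
    refine ⟨(isColoring_iff_isPermutedColoring _).2 h1, ?_⟩
    funext g
    rcases g with p | i
    · exact (congrFun h2 ((slidePerm x y z).symm p)).trans
        (congrArg (fun q => k (.inl q)) (Equiv.apply_symm_apply (slidePerm x y z) p))
    · rfl
  · intro X Y _ _ _ _ f k
    funext g
    rcases g with p | i
    · exact congrFun (hF' X Y f fun q => k (.inl q)) ((slidePerm x y z).symm p)
    · rfl
  · intro X Y _ _ _ _ f k
    funext g
    rcases g with p | i
    · exact congrFun (hG' X Y f fun q => k (.inl (slidePerm x y z q))) p
    · rfl

theorem slidePerm_of_ne {r : D.Passage} (h1 : r.1 ≠ x) (h2 : r.1 ≠ y) (h3 : r.1 ≠ z) :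
    slidePerm x y z r = r := by
  obtain ⟨w, b⟩ := r
  simp only [slidePerm, Equiv.Perm.mul_apply]
  rw [Equiv.swap_apply_of_ne_of_ne (a := (y, false)),
    Equiv.swap_apply_of_ne_of_ne (a := (x, false)),
    Equiv.swap_apply_of_ne_of_ne (a := (x, true))] <;> simp_all

theorem slidePerm_apply (hxy : x ≠ y) (hxz : x ≠ z) (hyz : y ≠ z) :
    slidePerm x y z (x, true) = (y, true) ∧
    slidePerm x y z (y, true) = (x, true) ∧ slidePerm x y z (x, false) = (z, true) ∧
    slidePerm x y z (z, true) = (x, false) ∧ slidePerm x y z (y, false) = (z, false) ∧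
    slidePerm x y z (z, false) = (y, false) := by
  simp [slidePerm, Equiv.Perm.mul_apply, Equiv.swap_apply_def, hxy, hxz, hyz, hxy.symm, hxz.symm,
    hyz.symm]

theorem solEquiv_slide (h : D.IsTriangle x y z) :
    SolEquiv D.IsColoring (D.slide x y z).IsColoring := by
  obtain ⟨hxy, hxz, hyz, a, b, c, ha, hb, hc, hs1, hs2⟩ := h
  obtain ⟨τ1, τ2, τ3, τ4, τ5, τ6⟩ := slidePerm_apply hxy hxz hyz
  have hε : D.sign y * c = D.sign x * b := by
    have := congrArg (a * ·) hs1
    simpa [mul_left_comm a, ← mul_assoc a a, Int.units_mul_self] using this.symm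
  set τ := slidePerm x y z with hτ
  set eM := D.dirEdge b (x, false) with heM
  set eB := D.dirEdge c (y, false) with heB
  set ε₁ := D.sign x * b with hε₁
  set ε₂ := D.sign z * c with hε₂
  have hneg : ∀ d : ℤˣ, ¬ -d = d := by decide
  have hneg' : ∀ d : ℤˣ, ¬ d = -d := by decide
  have hMB : eM ≠ eB := hc.dirEdge_ne (by simp [hxy]) (by simp [hxz])
  -- edges that keep their colors
  have n1 : D.dirEdge (-a) (x, true) ≠ eM := hb.dirEdge_ne (by simp) (by simp [hxz])
  have n2 : D.dirEdge a (x, true) ≠ eM := hb.dirEdge_ne (by simp) (by simp [hxz])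
  have n3 : D.dirEdge a (y, true) ≠ eM := hb.dirEdge_ne (by simp) (by simp [hyz])
  have n4 : D.dirEdge (-b) (x, false) ≠ eM :=
    hb.dirEdge_ne (fun h => hneg _ h.1) (by simp)
  have n5 : D.dirEdge b (z, true) ≠ eM :=
    hb.dirEdge_ne (by simp) (fun h => hneg' _ h.1)
  have n6 : D.dirEdge (-c) (y, false) ≠ eM := hb.dirEdge_ne (by simp [hxy.symm]) (by simp)
  have n7 : D.dirEdge c (z, false) ≠ eM := hb.dirEdge_ne (by simp [hxz.symm]) (by simp)
  have k1 : D.dirEdge (-a) (x, true) ≠ eB := hc.dirEdge_ne (by simp) (by simp)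
  have k2 : D.dirEdge a (x, true) ≠ eB := hc.dirEdge_ne (by simp) (by simp)
  have k3 : D.dirEdge a (y, true) ≠ eB := hc.dirEdge_ne (by simp) (by simp)
  have k4 : D.dirEdge (-b) (x, false) ≠ eB := hc.dirEdge_ne (by simp [hxy]) (by simp [hxz])
  have k5 : D.dirEdge b (z, true) ≠ eB := hc.dirEdge_ne (by simp) (by simp)
  have k6 : D.dirEdge (-c) (y, false) ≠ eB :=
    hc.dirEdge_ne (fun h => hneg _ h.1) (by simp [hyz])
  have k7 : D.dirEdge c (z, false) ≠ eB :=
    hc.dirEdge_ne (by simp [hyz.symm]) (fun h => hneg' _ h.1)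
  have nr (d : ℤˣ) (r : D.Passage) (h1 : r.1 ≠ x) (h2 : r.1 ≠ y) (h3 : r.1 ≠ z) :
      D.dirEdge d r ≠ eM ∧ D.dirEdge d r ≠ eB :=
    ⟨hb.dirEdge_ne (by rintro ⟨-, rfl⟩; simp at h1) (by rintro ⟨-, rfl⟩; simp at h3),
      hc.dirEdge_ne (by rintro ⟨-, rfl⟩; simp at h2) (by rintro ⟨-, rfl⟩; simp at h3)⟩
  -- the relations away from the triangle
  let Outer {X : Type} [AddCommGroup X] [Module ℤ[T;T⁻¹] X] (κ : D.Passage → X) : Prop :=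
    ∀ r : D.Passage, r.1 ≠ x → r.1 ≠ y → r.1 ≠ z → LocalRel κ r.2 r.1 (κ (r.1, true)) r
  have outer_recolor {X : Type} [AddCommGroup X] [Module ℤ[T;T⁻¹] X] {κ : D.Passage → X} (m b : X) :
      Outer κ → Outer (recolor eM eB m b κ) := by
    intro h r h1 h2 h3
    have := h r h1 h2 h3
    have e1 := nr 1 r h1 h2 h3
    have e2 := nr (-1) r h1 h2 h3
    have e3 := nr 1 (r.1, true) h1 h2 h3
    rw [dirEdge_one] at e1 e3
    rw [dirEdge_neg_one] at e2
    rw [LocalRel] at this ⊢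
    rwa [recolor_of_ne e1.1 e1.2, recolor_of_ne e2.1 e2.2, recolor_of_ne e3.1 e3.2]
  -- the color of an over-strand can be read off on both sides of the crossing
  have side {X : Type} [AddCommGroup X] [Module ℤ[T;T⁻¹] X] {κ : D.Passage → X} (d : ℤˣ)
      {p : D.Passage} {w : X} (h1 : κ (D.dirEdge (-d) p) = w) (h2 : κ (D.dirEdge d p) = w) :
      κ p = w := by
    rcases Int.units_eq_one_or d with rfl | rfl
    · rwa [dirEdge_one] at h2
    · rwa [neg_neg, dirEdge_one] at h1
  have hA {X : Type} [AddCommGroup X] [Module ℤ[T;T⁻¹] X] (κ : D.Passage → X) :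
      D.IsPermutedColoring 1 κ ↔ Outer κ ∧
        κ (D.dirEdge a (x, true)) = κ (D.dirEdge (-a) (x, true)) ∧
        κ (D.dirEdge a (y, true)) = κ (D.dirEdge (-a) (x, true)) ∧
        κ eM = act ε₁ (κ (D.dirEdge (-a) (x, true))) (κ (D.dirEdge (-b) (x, false))) ∧
        κ (D.dirEdge b (z, true)) = κ eM ∧
        κ eB = act ε₁ (κ (D.dirEdge (-a) (x, true))) (κ (D.dirEdge (-c) (y, false))) ∧
        κ (D.dirEdge c (z, false)) = act ε₂ (κ eM) (κ eB) := by
    constructor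
    · intro h
      have r1 := (localRel_true a).1 (h (x, true))
      have r2 := (localRel_true a).1 (h (y, true))
      have r3 := (localRel_false b).1 (h (x, false))
      have r4 := (localRel_true b).1 (h (z, true))
      have r5 := (localRel_false c).1 (h (y, false))
      have r6 := (localRel_false c).1 (h (z, false))
      rw [ha.dirEdge_eq, r1] at r2
      rw [hb.dirEdge_eq] at r4
      have o1 := side a rfl r1
      have o2 := side a (ha.dirEdge_eq ▸ r1) r2
      have o3 := side b (by rw [hb.dirEdge_eq]) r4
      refine ⟨fun r _ _ _ => h r, r1, r2, ?_, r4, ?_, ?_⟩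
      · rw [← o1]; exact r3
      · rw [← o2, ← hε]; exact r5
      · rw [← o3, heB, ← hc.dirEdge_eq]; exact r6
    · rintro ⟨h0, r1, r2, r3, r4, r5, r6⟩ ⟨w, v⟩
      have o1 := side a rfl r1
      have o2 := side a (ha.dirEdge_eq ▸ r1) r2
      have o3 := side b (by rw [hb.dirEdge_eq]) r4
      by_cases hwx : w = x
      · subst hwx
        cases v
        · refine (localRel_false b).2 ?_
          rw [← o1] at r3; exact r3
        · exact (localRel_true a).2 r1
      by_cases hwy : w = y
      · subst hwy
        cases v
        · refine (localRel_false c).2 ?_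
          rw [← o2, ← hε] at r5; exact r5
        · refine (localRel_true a).2 ?_
          rw [ha.dirEdge_eq, r1]; exact r2
      by_cases hwz : w = z
      · subst hwz
        cases v
        · refine (localRel_false c).2 ?_
          rw [← o3, heB, ← hc.dirEdge_eq] at r6; exact r6
        · refine (localRel_true b).2 ?_
          rw [hb.dirEdge_eq]; exact r4
      exact h0 (w, v) hwx hwy hwz
  have τs1 : τ.symm (y, true) = (x, true) := by rw [Equiv.symm_apply_eq, τ1]
  have τs2 : τ.symm (x, true) = (y, true) := by rw [Equiv.symm_apply_eq, τ2]
  have τs3 : τ.symm (z, true) = (x, false) := by rw [Equiv.symm_apply_eq, τ3]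
  have hB {X : Type} [AddCommGroup X] [Module ℤ[T;T⁻¹] X] (κ : D.Passage → X) :
      D.IsPermutedColoring τ κ ↔ Outer κ ∧
        κ (D.dirEdge a (x, true)) = κ (D.dirEdge (-a) (x, true)) ∧
        κ (D.dirEdge a (y, true)) = κ (D.dirEdge (-a) (x, true)) ∧
        κ eM = κ (D.dirEdge (-b) (x, false)) ∧
        κ (D.dirEdge b (z, true)) = act ε₁ (κ (D.dirEdge (-a) (x, true))) (κ eM) ∧
        κ eB = act ε₂ (κ (D.dirEdge (-b) (x, false))) (κ (D.dirEdge (-c) (y, false))) ∧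
        κ (D.dirEdge c (z, false)) = act ε₁ (κ (D.dirEdge (-a) (x, true))) (κ eB) := by
    constructor
    · intro h
      have r1 := h (x, true)
      have r2 := h (y, true)
      have r3 := h (x, false)
      have r4 := h (z, true)
      have r5 := h (y, false)
      have r6 := h (z, false)
      rw [τ1, localRel_true a] at r1
      rw [τ2, localRel_true a, ha.dirEdge_eq, r1] at r2
      rw [τ3, localRel_true b] at r3
      rw [τ4, localRel_false b, hb.dirEdge_eq] at r4
      rw [τ5, localRel_false c] at r5
      rw [τ6, localRel_false c, hc.dirEdge_eq] at r6
      simp only [τs1, τs2, τs3] at r4 r5 r6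
      rw [side a (ha.dirEdge_eq ▸ r1) r2] at r4
      rw [side b rfl r3] at r5
      rw [side a rfl r1, hε] at r6
      refine ⟨fun r h1 h2 h3 => ?_, r1, r2, r3, r4, r5, r6⟩
      have := h r
      rwa [slidePerm_of_ne h1 h2 h3,
        (Equiv.symm_apply_eq _).2 (slidePerm_of_ne (r := (r.1, true)) h1 h2 h3).symm]
        at this
    · rintro ⟨h0, r1, r2, r3, r4, r5, r6⟩ ⟨w, v⟩
      have o1 := side a rfl r1
      have o2 := side a (ha.dirEdge_eq ▸ r1) r2
      have o3 := side b rfl r3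
      by_cases hwx : w = x
      · subst hwx
        cases v
        · rw [τ3]
          exact (localRel_true b).2 r3
        · rw [τ1]
          exact (localRel_true a).2 r1
      by_cases hwy : w = y
      · subst hwy
        cases v
        · rw [τ5, localRel_false c]
          simp only [τs3, o3]
          exact r5
        · rw [τ2, localRel_true a, ha.dirEdge_eq, r1]
          exact r2
      by_cases hwz : w = z
      · subst hwz
        cases v
        · rw [τ6, localRel_false c, hc.dirEdge_eq]
          simp only [τs1, o1, hε]
          exact r6
        · rw [τ4, localRel_false b, hb.dirEdge_eq]
          simp only [τs2, o2]
          exact r4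
      have := h0 (w, v) hwx hwy hwz
      rwa [slidePerm_of_ne (r := (w, v)) hwx hwy hwz, (Equiv.symm_apply_eq _).2
        (slidePerm_of_ne (r := (w, true)) hwx hwy hwz).symm]
  have hdist {X : Type} [AddCommGroup X] [Module ℤ[T;T⁻¹] X] (t m w : X) :
      act ε₂ (act ε₁ t m) (act ε₁ t w) = act ε₁ t (act ε₂ m w) := (act_act _ _ _ _ _).symm
  let F (X : Type) [AddCommGroup X] [Module ℤ[T;T⁻¹] X] (κ : D.Passage → X) : D.Passage → X :=
    recolor eM eB (κ (D.dirEdge (-b) (x, false)))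
      (act ε₂ (κ (D.dirEdge (-b) (x, false))) (κ (D.dirEdge (-c) (y, false)))) κ
  let G (X : Type) [AddCommGroup X] [Module ℤ[T;T⁻¹] X] (κ : D.Passage → X) : D.Passage → X :=
    recolor eM eB
      (act ε₁ (κ (D.dirEdge (-a) (x, true))) (κ (D.dirEdge (-b) (x, false))))
      (act ε₁ (κ (D.dirEdge (-a) (x, true))) (κ (D.dirEdge (-c) (y, false)))) κ
  have hF (X : Type) [AddCommGroup X] [Module ℤ[T;T⁻¹] X] (κ : D.Passage → X)
      (h : D.IsPermutedColoring 1 κ) : D.IsPermutedColoring τ (F X κ) ∧ G X (F X κ) = κ := by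
    obtain ⟨h0, r1, r2, r3, r4, r5, r6⟩ := (hA κ).1 h
    refine ⟨(hB _).2 ⟨outer_recolor _ _ h0, ?_⟩, ?_⟩
    · simp only [F, recolor_fst hMB, recolor_snd, recolor_of_ne n1 k1, recolor_of_ne n2 k2,
        recolor_of_ne n3 k3, recolor_of_ne n4 k4, recolor_of_ne n5 k5, recolor_of_ne n6 k6,
        recolor_of_ne n7 k7, true_and]
      exact ⟨r1, r2, by rw [r4, r3], by rw [r6, r3, r5, hdist]⟩
    · simp only [F, G, recolor_recolor hMB, recolor_of_ne n1 k1, recolor_of_ne n4 k4,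
        recolor_of_ne n6 k6]
      exact recolor_eq_self r3 r5
  have hG (X : Type) [AddCommGroup X] [Module ℤ[T;T⁻¹] X] (κ : D.Passage → X)
      (h : D.IsPermutedColoring τ κ) : D.IsPermutedColoring 1 (G X κ) ∧ F X (G X κ) = κ := by
    obtain ⟨h0, r1, r2, r3, r4, r5, r6⟩ := (hB κ).1 h
    refine ⟨(hA _).2 ⟨outer_recolor _ _ h0, ?_⟩, ?_⟩
    · simp only [G, recolor_fst hMB, recolor_snd, recolor_of_ne n1 k1, recolor_of_ne n2 k2,
        recolor_of_ne n3 k3, recolor_of_ne n4 k4, recolor_of_ne n5 k5, recolor_of_ne n6 k6,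
        recolor_of_ne n7 k7, true_and]
      exact ⟨r1, r2, by rw [r4, r3], by rw [r6, r5, hdist]⟩
    · simp only [F, G, recolor_recolor hMB, recolor_of_ne n4 k4, recolor_of_ne n6 k6]
      exact recolor_eq_self r3 r5
  refine solEquiv_slide_of_maps F G hF hG ?_ ?_
  · intro X Y _ _ _ _ f κ
    simp only [F, recolor, Function.comp_update, map_act, Function.comp_apply]
  · intro X Y _ _ _ _ f κ
    simp only [G, recolor, Function.comp_update, map_act, Function.comp_apply]

end Triangle

end GaussDiagram

/-! ### The Alexander polynomial of a link -/

namespace GaussDiagram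

theorem isAlexanderPolynomial_of_isEmpty {D : GaussDiagram} [IsEmpty D.Gen] (Δ : ℤ[T;T⁻¹]) :
    D.IsAlexanderPolynomial Δ ↔ ∀ q, q ∣ Δ ↔ q ∣ 1 := by
  have h : Fintype.card D.Gen - 1 = 0 := by rw [Fintype.card_eq_zero]
  have hdet (r : Fin (Fintype.card D.Gen - 1) → D.Passage)
      (c : Fin (Fintype.card D.Gen - 1) → D.Gen) : (D.alexanderMatrix.submatrix r c).det = 1 := by
    have : IsEmpty (Fin (Fintype.card D.Gen - 1)) := by rw [h]; infer_instance
    exact Matrix.det_isEmpty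
  refine forall_congr' fun q => iff_congr Iff.rfl ?_
  simp only [hdet]
  have : IsEmpty (Fin (Fintype.card D.Gen - 1)) := by rw [h]; infer_instance
  exact ⟨fun h => h isEmptyElim isEmptyElim, fun h _ _ => h⟩

theorem isAlexanderPolynomial_congr_of_nonempty_iff {D D' : GaussDiagram}
    (hne : Nonempty D.Gen ↔ Nonempty D'.Gen) (h : SolEquiv D.IsColoring D'.IsColoring)
    (Δ : ℤ[T;T⁻¹]) : D.IsAlexanderPolynomial Δ ↔ D'.IsAlexanderPolynomial Δ := by
  rcases isEmpty_or_nonempty D.Gen with hD | hD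
  · have : IsEmpty D'.Gen := by
      rw [← not_nonempty_iff, ← hne, not_nonempty_iff]
      exact hD
    rw [isAlexanderPolynomial_of_isEmpty, isAlexanderPolynomial_of_isEmpty]
  · have := hne.1 hD
    exact isAlexanderPolynomial_congr h Δ

theorem nonempty_gen_iff (D : GaussDiagram) : Nonempty D.Gen ↔ D.numComponents ≠ 0 := by
  rw [numComponents, Ne, Nat.add_eq_zero_iff, Finite.card_eq_zero_iff, nonempty_sum, not_and_or,
    or_comm, not_isEmpty_iff, ← Fin.pos_iff_nonempty, Nat.pos_iff_ne_zero]
  exact or_congr Iff.rfl (Nonempty.congr (Quot.mk _) Quot.out)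

theorem Forgets.nonempty_gen_iff {D D' : GaussDiagram} {S : Set (Fin D.numCrossings)}
    (h : D.Forgets D' S) : Nonempty D.Gen ↔ Nonempty D'.Gen := by
  obtain ⟨φ, -, -, -, hcomp⟩ := h
  rw [D.nonempty_gen_iff, D'.nonempty_gen_iff, hcomp]

theorem isAlexanderPolynomial_slide_iff {D : GaussDiagram} {x y z : Fin D.numCrossings}
    (h : D.IsTriangle x y z) (Δ : ℤ[T;T⁻¹]) :
    D.IsAlexanderPolynomial Δ ↔ (D.slide x y z).IsAlexanderPolynomial Δ :=
  have hne : Nonempty D.Gen ↔ Nonempty (D.slide x y z).Gen := Iff.refl (Nonempty D.Gen)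
  isAlexanderPolynomial_congr_of_nonempty_iff hne (solEquiv_slide h) Δ

end GaussDiagram

open GaussDiagram in
theorem ReidemeisterMove.isAlexanderPolynomial_iff {D D' : LinkDiagram} (h : ReidemeisterMove D D')
    (Δ : ℤ[T;T⁻¹]) : D.IsAlexanderPolynomial Δ ↔ D'.IsAlexanderPolynomial Δ := by
  cases h with
  | rename h =>
    exact isAlexanderPolynomial_congr_of_nonempty_iff h.nonempty_gen_iff
      ((SolEquiv.of_iff fun _ _ _ c => isReducedColoring_empty_iff c).trans h.solEquiv) Δ
  | one x b hx h =>
    exact isAlexanderPolynomial_congr_of_nonempty_iff h.nonempty_gen_iff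
      ((SolEquiv.of_iff fun _ _ _ c => isReducedColoring_singleton_iff hx c).trans h.solEquiv) Δ
  | two x y hxy hsign hover hunder h =>
    exact isAlexanderPolynomial_congr_of_nonempty_iff h.nonempty_gen_iff
      ((solEquiv_of_bigon hxy hsign hover hunder).trans h.solEquiv) Δ
  | three x y z hxyz h =>
    rw [h]
    exact isAlexanderPolynomial_slide_iff hxyz Δ

/-- All diagrams of a link have the same Alexander polynomial. -/
theorem Link.isAlexanderPolynomial_of_mk_eq {D D' : LinkDiagram}
    (h : (Quot.mk ReidemeisterMove D : Link) = Quot.mk ReidemeisterMove D') (Δ : ℤ[T;T⁻¹]) :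
    D.IsAlexanderPolynomial Δ ↔ D'.IsAlexanderPolynomial Δ := by
  replace h := Quot.eqvGen_exact h
  induction h with
  | rel _ _ h => exact h.isAlexanderPolynomial_iff Δ
  | refl => exact Iff.rfl
  | symm _ _ _ ih => exact ih.symm
  | trans _ _ _ _ _ ih₁ ih₂ => exact ih₁.trans ih₂

/-! ### The Alexander numbering of the faces of a planar diagram -/

namespace GaussDiagram

variable (D : GaussDiagram)

/-- Faces of a diagram. -/
abbrev Face : Type := Quot fun d e : D.Passage × Bool => D.leftTurn d = e

/-- Connected pieces of a diagram. -/
abbrev Piece : Type :=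
  Quot fun x y : Fin D.numCrossings => ∃ b b' : Bool, D.next (x, b) = (y, b')

/-- The face on the left of an edge. -/
def leftFace (p : D.Passage) : D.Face := Quot.mk _ (p, true)

/-- The face on the right of an edge. -/
def rightFace (p : D.Passage) : D.Face := Quot.mk _ (p, false)

variable {D}

theorem leftFace_eq_of_pos {x : Fin D.numCrossings} (h : D.sign x = 1) :
    D.leftFace (D.next.symm (x, true)) = D.leftFace (x, false) ∧
    D.rightFace (x, true) = D.rightFace (D.next.symm (x, false)) ∧
    D.leftFace (D.next.symm (x, false)) = D.rightFace (D.next.symm (x, true)) ∧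
    D.rightFace (x, false) = D.leftFace (x, true) := by
  refine ⟨Quot.sound ?_, Quot.sound ?_, Quot.sound ?_, Quot.sound ?_⟩ <;> simp [leftTurn, h]

theorem leftFace_eq_of_neg {x : Fin D.numCrossings} (h : D.sign x = -1) :
    D.leftFace (D.next.symm (x, true)) = D.rightFace (D.next.symm (x, false)) ∧
    D.rightFace (x, true) = D.leftFace (x, false) ∧
    D.leftFace (D.next.symm (x, false)) = D.leftFace (x, true) ∧
    D.rightFace (x, false) = D.rightFace (D.next.symm (x, true)) := by
  refine ⟨Quot.sound ?_, Quot.sound ?_, Quot.sound ?_, Quot.sound ?_⟩ <;> simp [leftTurn, h]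

variable (D) in
/-- The jump of a function on the faces across each edge. -/
def jump : (D.Face → ℚ) →ₗ[ℚ] (D.Passage → ℚ) where
  toFun f p := f (D.leftFace p) - f (D.rightFace p)
  map_add' f g := by ext p; simp; ring
  map_smul' r f := by ext p; simp; ring

variable (D) in
/-- The incidence matrix of crossings and edges. -/
def incidence : Matrix (Fin D.numCrossings) D.Passage ℚ :=
  Matrix.of fun x p => (if p.1 = x then 1 else 0) - (if (D.next p).1 = x then 1 else 0)

theorem incidence_mulVec (h : D.Passage → ℚ) (x : Fin D.numCrossings) :
    D.incidence.mulVec h x = h (x, true) + h (x, false) -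
      (h (D.next.symm (x, true)) + h (D.next.symm (x, false))) := by
  have h1 (k : D.Passage → ℚ) : ∑ p : D.Passage, (if p.1 = x then 1 else 0) * k p =
      k (x, true) + k (x, false) := by
    rw [Fintype.sum_prod_type, Finset.sum_eq_single x] <;> simp +contextual
  have h2 : ∑ p : D.Passage, (if (D.next p).1 = x then 1 else 0) * h p =
      h (D.next.symm (x, true)) + h (D.next.symm (x, false)) := by
    rw [← h1 fun q => h (D.next.symm q), ← Equiv.sum_comp D.next
      fun q => (if q.1 = x then 1 else 0) * h (D.next.symm q)]
    simp only [Equiv.symm_apply_apply]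
  simp only [Matrix.mulVec, dotProduct, incidence, Matrix.of_apply, sub_mul,
    Finset.sum_sub_distrib, h1, h2]

theorem incidence_transpose_mulVec (g : Fin D.numCrossings → ℚ) (p : D.Passage) :
    D.incidence.transpose.mulVec g p = g p.1 - g (D.next p).1 := by
  simp [Matrix.mulVec, dotProduct, incidence, sub_mul, Finset.sum_sub_distrib]

theorem range_jump_le : LinearMap.range D.jump ≤ LinearMap.ker D.incidence.mulVecLin := by
  rintro _ ⟨f, rfl⟩
  rw [LinearMap.mem_ker]
  ext x
  rw [Matrix.mulVecLin_apply, incidence_mulVec]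
  simp only [jump, LinearMap.coe_mk, AddHom.coe_mk, Pi.zero_apply]
  rcases Int.units_eq_one_or (D.sign x) with h | h
  · obtain ⟨h1, h2, h3, h4⟩ := leftFace_eq_of_pos h
    rw [h1, h2, h3, h4]; ring
  · obtain ⟨h1, h2, h3, h4⟩ := leftFace_eq_of_neg h
    rw [h1, h2, h3, h4]; ring

theorem finrank_ker_jump_le : Module.finrank ℚ (LinearMap.ker D.jump) ≤ D.numPieces := by
  have key (f : LinearMap.ker D.jump) (p : D.Passage) :
      f.1 (D.leftFace p) = f.1 (D.rightFace p) := by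
    have := congrFun (LinearMap.mem_ker.1 f.2) p
    exact sub_eq_zero.1 this
  have key2 (f : LinearMap.ker D.jump) (x : Fin D.numCrossings) :
      f.1 (D.leftFace (x, false)) = f.1 (D.leftFace (x, true)) ∧
      f.1 (D.leftFace (D.next.symm (x, true))) = f.1 (D.leftFace (x, true)) ∧
      f.1 (D.leftFace (D.next.symm (x, false))) = f.1 (D.leftFace (x, true)) := by
    have k1 := key f (x, true)
    have k2 := key f (x, false)
    have k3 := key f (D.next.symm (x, true))
    have k4 := key f (D.next.symm (x, false))
    rcases Int.units_eq_one_or (D.sign x) with h | h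
    · obtain ⟨h1, h2, h3, h4⟩ := leftFace_eq_of_pos h
      replace h1 := congrArg f.1 h1
      replace h2 := congrArg f.1 h2
      replace h3 := congrArg f.1 h3
      replace h4 := congrArg f.1 h4
      refine ⟨?_, ?_, ?_⟩ <;> linarith
    · obtain ⟨h1, h2, h3, h4⟩ := leftFace_eq_of_neg h
      replace h1 := congrArg f.1 h1
      replace h2 := congrArg f.1 h2
      replace h3 := congrArg f.1 h3
      replace h4 := congrArg f.1 h4
      refine ⟨?_, ?_, ?_⟩ <;> linarith
  let e : LinearMap.ker D.jump →ₗ[ℚ] (D.Piece → ℚ) :=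
    { toFun f := Quot.lift (fun x => f.1 (D.leftFace (x, true))) (by
        rintro x y ⟨b, b', h⟩
        have hb : f.1 (D.leftFace (x, b)) = f.1 (D.leftFace (x, true)) := by
          cases b
          exacts [(key2 f x).1, rfl]
        have hb' : f.1 (D.leftFace (D.next.symm (y, b'))) = f.1 (D.leftFace (y, true)) := by
          cases b'
          exacts [(key2 f y).2.2, (key2 f y).2.1]
        rw [← h, Equiv.symm_apply_apply] at hb'
        exact hb.symm.trans hb')
      map_add' f g := by ext z; induction z using Quot.ind; rfl
      map_smul' r f := by ext z; induction z using Quot.ind; rfl }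
  have he : Function.Injective e := by
    intro f g h
    apply Subtype.ext
    have h1 (x : Fin D.numCrossings) : f.1 (D.leftFace (x, true)) = g.1 (D.leftFace (x, true)) :=
      congrFun h (Quot.mk _ x)
    have h2 (p : D.Passage) : f.1 (D.leftFace p) = g.1 (D.leftFace p) := by
      obtain ⟨x, b⟩ := p
      cases b
      · rw [(key2 f x).1, (key2 g x).1, h1]
      · exact h1 x
    funext z
    induction z using Quot.ind with | mk d => ?_
    obtain ⟨p, b⟩ := d
    cases b
    · exact (key f p).symm.trans ((h2 p).trans (key g p))
    · exact h2 p
  have := LinearMap.finrank_le_finrank_of_injective he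
  have := Fintype.ofFinite D.Piece
  rwa [Module.finrank_fintype_fun_eq_card, ← Nat.card_eq_fintype_card] at *

theorem finrank_ker_incidence_transpose_le :
    Module.finrank ℚ (LinearMap.ker D.incidence.transpose.mulVecLin) ≤ D.numPieces := by
  have key (g : LinearMap.ker D.incidence.transpose.mulVecLin) (p : D.Passage) :
      g.1 p.1 = g.1 (D.next p).1 := by
    have := congrFun (LinearMap.mem_ker.1 g.2) p
    rw [Matrix.mulVecLin_apply, incidence_transpose_mulVec] at this
    exact sub_eq_zero.1 this
  let e : LinearMap.ker D.incidence.transpose.mulVecLin →ₗ[ℚ] (D.Piece → ℚ) :=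
    { toFun g := Quot.lift g.1 (by
        rintro x y ⟨b, b', h⟩
        have := key g (x, b)
        rwa [h] at this)
      map_add' f g := by ext z; induction z using Quot.ind; rfl
      map_smul' r f := by ext z; induction z using Quot.ind; rfl }
  have he : Function.Injective e := fun f g h =>
    Subtype.ext (funext fun x => congrFun h (Quot.mk _ x))
  have := LinearMap.finrank_le_finrank_of_injective he
  have := Fintype.ofFinite D.Piece
  rwa [Module.finrank_fintype_fun_eq_card, ← Nat.card_eq_fintype_card] at *

/-- On a planar diagram every circulation is the jump of a function on the faces, by a count of
dimensions. -/
theorem IsPlanar.range_jump (h : D.IsPlanar) :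
    LinearMap.range D.jump = LinearMap.ker D.incidence.mulVecLin := by
  refine Submodule.eq_of_le_of_finrank_le range_jump_le ?_
  have h1 := LinearMap.finrank_range_add_finrank_ker D.jump
  have h2 := LinearMap.finrank_range_add_finrank_ker D.incidence.mulVecLin
  have h3 := LinearMap.finrank_range_add_finrank_ker D.incidence.transpose.mulVecLin
  have h4 := D.incidence.rank_transpose
  have h5 := finrank_ker_jump_le (D := D)
  have h6 := finrank_ker_incidence_transpose_le (D := D)
  have hF : Module.finrank ℚ (D.Face → ℚ) = D.numFaces := by
    have := Fintype.ofFinite D.Face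
    rw [Module.finrank_fintype_fun_eq_card, ← Nat.card_eq_fintype_card]
    rfl
  rw [Matrix.rank, Matrix.rank] at h4
  rw [hF, h] at h1
  simp only [Module.finrank_fintype_fun_eq_card, Fintype.card_prod, Fintype.card_fin,
    Fintype.card_bool] at h2 h3
  omega

/-- The faces of a planar diagram can be numbered such that the number on the left of every edge
exceeds the number on its right by one. -/
theorem IsPlanar.exists_numbering (h : D.IsPlanar) :
    ∃ f : D.Face → ℤ, ∀ p, f (D.leftFace p) = f (D.rightFace p) + 1 := by
  have h1 : (fun _ => 1 : D.Passage → ℚ) ∈ LinearMap.ker D.incidence.mulVecLin := by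
    rw [LinearMap.mem_ker]
    ext x
    rw [Matrix.mulVecLin_apply, incidence_mulVec]
    simp
  rw [← h.range_jump] at h1
  obtain ⟨f, hf⟩ := h1
  refine ⟨fun z => ⌊f z⌋, fun p => ?_⟩
  have : f (D.leftFace p) - f (D.rightFace p) = 1 := congrFun hf p
  rw [← Int.floor_add_one, ← this]
  ring_nf

/-- A relation between the rows of the Alexander matrix of a planar diagram, all of whose
coefficients are units. -/
theorem IsPlanar.exists_vecMul_alexanderMatrix (h : D.IsPlanar) :
    ∃ u : D.Passage → ℤ[T;T⁻¹], (∀ p, IsUnit (u p)) ∧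
      Matrix.vecMul u D.alexanderMatrix = 0 := by
  obtain ⟨f, hf⟩ := h.exists_numbering
  let j : D.Passage → ℤ := fun p => -f (D.rightFace p)
  let w : D.Passage → ℤ[T;T⁻¹] := fun p => LaurentPolynomial.T (j p)
  -- the coefficients are such that every edge receives `w` at its end and `-w` at its beginning
  let u : D.Passage → ℤ[T;T⁻¹] := fun p =>
    if p.2 then -w (D.next.symm (p.1, true))
    else if D.sign p.1 = 1 then w (D.next.symm (p.1, true)) else -w (p.1, true)
  have hw (p q : D.Passage) (h : j q = 1 + j p) : w q = LaurentPolynomial.T 1 * w p := by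
    simp only [w, h, LaurentPolynomial.T_add]
  have m1 (x : Fin D.numCrossings) : D.alexanderMatrix (x, true) =
      D.outEdge (x, true) - D.outEdge (D.next.symm (x, true)) := rfl
  have m2 (x : Fin D.numCrossings) : D.alexanderMatrix (x, false) =
      if D.sign x = 1 then (1 - LaurentPolynomial.T 1 : ℤ[T;T⁻¹]) • D.outEdge (x, true) +
        (LaurentPolynomial.T 1 : ℤ[T;T⁻¹]) • D.outEdge (D.next.symm (x, false)) -
          D.outEdge (x, false)
      else (1 - LaurentPolynomial.T 1 : ℤ[T;T⁻¹]) • D.outEdge (x, true) +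
        (LaurentPolynomial.T 1 : ℤ[T;T⁻¹]) • D.outEdge (x, false) -
          D.outEdge (D.next.symm (x, false)) := rfl
  have key (x : Fin D.numCrossings) :
      u (x, true) • D.alexanderMatrix (x, true) + u (x, false) • D.alexanderMatrix (x, false) =
        (w (D.next.symm (x, true)) • D.outEdge (D.next.symm (x, true)) -
          w (x, true) • D.outEdge (x, true)) +
        (w (D.next.symm (x, false)) • D.outEdge (D.next.symm (x, false)) -
          w (x, false) • D.outEdge (x, false)) := by
    have f1 := hf (x, true)
    have f2 := hf (x, false)
    have f3 := hf (D.next.symm (x, true))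
    have f4 := hf (D.next.symm (x, false))
    rcases Int.units_eq_one_or (D.sign x) with h | h
    · obtain ⟨h1, h2, h3, h4⟩ := leftFace_eq_of_pos h
      rw [h1] at f3
      rw [h3] at f4
      rw [← h4] at f1
      have e1 : w (x, true) = LaurentPolynomial.T 1 * w (D.next.symm (x, true)) :=
        hw _ _ (by simp only [j]; omega)
      have e2 : w (D.next.symm (x, false)) =
          LaurentPolynomial.T 1 * w (D.next.symm (x, true)) := hw _ _ (by simp only [j]; omega)
      have e3 : w (x, false) = w (D.next.symm (x, true)) := by
        simp only [w]; congr 1; simp only [j]; omega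
      simp only [m1, m2, u, h, if_true, Bool.false_eq_true,
        if_false, e1, e2, e3]
      module
    · obtain ⟨h1, h2, h3, h4⟩ := leftFace_eq_of_neg h
      rw [h1] at f3
      rw [h3] at f4
      rw [← h2, h4] at f2
      have e1 : w (D.next.symm (x, true)) = LaurentPolynomial.T 1 * w (x, true) :=
        hw _ _ (by simp only [j]; omega)
      have e2 : w (x, false) = LaurentPolynomial.T 1 * w (x, true) :=
        hw _ _ (by simp only [j]; rw [h4]; omega)
      have e3 : w (D.next.symm (x, false)) = w (x, true) := by
        simp only [w]; congr 1; simp only [j]; omega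
      have hs : ¬ ((-1 : ℤˣ) = 1) := by decide
      simp only [m1, m2, u, h, hs, if_true, Bool.false_eq_true,
        if_false, e1, e2, e3]
      module
  have hT (n : ℤ) : IsUnit (LaurentPolynomial.T n : ℤ[T;T⁻¹]) := LaurentPolynomial.isUnit_T n
  refine ⟨u, fun p => ?_, ?_⟩
  · simp only [u]
    split_ifs
    exacts [(hT _).neg, hT _, (hT _).neg]
  · rw [Matrix.vecMul_eq_sum, Fintype.sum_prod_type]
    simp only [Fintype.sum_bool, key]
    have := Equiv.sum_comp D.next.symm fun p => w p • D.outEdge p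
    rw [Fintype.sum_prod_type, Fintype.sum_prod_type] at this
    simp only [Fintype.sum_bool, Finset.sum_add_distrib] at this
    simp only [Finset.sum_add_distrib, Finset.sum_sub_distrib]
    rw [sub_add_sub_comm, this, sub_self]

end GaussDiagram

/-! ### Determinants of rooted Laplacians -/

section Laplacian

variable {ι : Type*} [Fintype ι] [DecidableEq ι]

/-- The adjacency matrix of a partial function, the directed graph in which every vertex has at
most one outgoing edge. -/
def partialFunMatrix (f : ι → Option ι) : Matrix ι ι ℤ :=
  Matrix.of fun i j => if f i = some j then 1 else 0

theorem partialFunMatrix_mulVec (f : ι → Option ι) (v : ι → ℤ) (i : ι) :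
    (partialFunMatrix f).mulVec v i = (f i).elim 0 v := by
  simp only [Matrix.mulVec, dotProduct, partialFunMatrix, Matrix.of_apply, ite_mul, one_mul,
    zero_mul]
  cases h : f i with
  | none => simp
  | some j => simp

theorem partialFunMatrix_pow (f : ι → Option ι) (m : ℕ) (i j : ι) :
    (partialFunMatrix f ^ m) i j =
      if (fun o : Option ι => o.bind f)^[m] (some i) = some j then 1 else 0 := by
  induction m generalizing i with
  | zero => simp [Matrix.one_apply]
  | succ m ih =>
    rw [pow_succ', Function.iterate_succ_apply]
    change (partialFunMatrix f).mulVec (fun k => (partialFunMatrix f ^ m) k j) i = _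
    rw [partialFunMatrix_mulVec]
    cases h : f i with
    | none =>
      have : (fun o : Option ι => o.bind f)^[m] none = none :=
        Function.iterate_fixed rfl m
      simp [h, this]
    | some k => simp [h, ih]

/-- The graph of a partial function contributes `1` if it is a forest and `0` if it has a cycle. -/
theorem det_one_sub_partialFunMatrix (f : ι → Option ι) :
    (1 - partialFunMatrix f).det = 0 ∨ (1 - partialFunMatrix f).det = 1 := by
  classical
  set g : Option ι → Option ι := fun o => o.bind f with hg
  by_cases h : ∀ i, ∃ m, g^[m] (some i) = none
  · right
    choose m hm using h
    have hnil : IsNilpotent (partialFunMatrix f) := by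
      refine ⟨∑ i, m i, ?_⟩
      ext i j
      rw [partialFunMatrix_pow, Matrix.zero_apply, if_neg]
      obtain ⟨k, hk⟩ : ∃ k, ∑ i, m i = k + m i :=
        Nat.exists_eq_add_of_le' (Finset.single_le_sum (fun _ _ => Nat.zero_le _)
          (Finset.mem_univ i))
      rw [hk, Function.iterate_add_apply, hm, Function.iterate_fixed rfl]
      simp
    have h1 := (Matrix.isNilpotent_charpoly_sub_pow_of_isNilpotent hnil).eq_zero
    have h2 := (partialFunMatrix f).eval_charpoly 1
    rw [sub_eq_zero.1 h1] at h2
    simpa using h2.symm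
  · left
    push Not at h
    obtain ⟨i₀, hi₀⟩ := h
    -- the vertices from which the path never ends span a kernel vector
    refine Matrix.exists_mulVec_eq_zero_iff.1
      ⟨fun i => if ∃ m, g^[m] (some i) = none then 0 else 1, ?_, ?_⟩
    · intro h
      have := congrFun h i₀
      simp [hi₀] at this
    · ext i
      rw [Matrix.sub_mulVec, Matrix.one_mulVec, Pi.sub_apply, partialFunMatrix_mulVec]
      have key : (∃ m, g^[m] (some i) = none) ↔ ∃ m, g^[m] (f i) = none := by
        constructor
        · rintro ⟨m, hm⟩
          cases m with
          | zero => simp at hm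
          | succ m => exact ⟨m, hm⟩
        · rintro ⟨m, hm⟩
          exact ⟨m + 1, hm⟩
      rw [key, Pi.zero_apply]
      cases h : f i with
      | none => simpa using ⟨0, rfl⟩
      | some j => simp

/-- The matrix-tree theorem in a weak form: if the edges from `i` to `f i k` have weights `w i k`,
where `none` is the root, then the determinant of the Laplacian is a sum of products of weights. -/
theorem det_laplacian_mem {R κ : Type*} [CommRing R] [Fintype κ] [DecidableEq κ] (C : Subsemiring R)
    (w : ι → κ → R) (hw : ∀ i k, w i k ∈ C) (f : ι → κ → Option ι) (L : Matrix ι ι R)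
    (hL : ∀ i, L i = ∑ k, w i k •
      fun j => (if i = j then 1 else 0) - (if f i k = some j then 1 else 0)) : L.det ∈ C := by
  have h : L = fun i => ∑ k, w i k •
      fun j => (if i = j then 1 else 0) - (if f i k = some j then 1 else 0) := funext hL
  rw [h]
  change Matrix.detRowAlternating.toMultilinearMap _ ∈ C
  rw [MultilinearMap.map_sum]
  refine Subsemiring.sum_mem C fun φ _ => ?_
  rw [MultilinearMap.map_smul_univ, smul_eq_mul]
  refine C.mul_mem (Subsemiring.prod_mem C fun i _ => hw _ _) ?_
  have : (Matrix.of fun i j => (if i = j then (1 : R) else 0) -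
      (if f i (φ i) = some j then 1 else 0)) =
      (1 - partialFunMatrix fun i => f i (φ i)).map (Int.castRingHom R) := by
    ext i j
    simp only [Matrix.of_apply, partialFunMatrix, Matrix.map_apply, Matrix.sub_apply,
      Matrix.one_apply, map_sub]
    split_ifs <;> simp
  change (Matrix.of fun i j => (if i = j then (1 : R) else 0) -
      (if f i (φ i) = some j then 1 else 0)).det ∈ C
  rw [this, ← RingHom.mapMatrix_apply, ← RingHom.map_det]
  rcases det_one_sub_partialFunMatrix fun i => f i (φ i) with h | h <;> rw [h]
  · simp
  · simp

end Laplacian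

/-! ### Cofactors of a matrix with one-dimensional kernels -/

section Cofactors

variable {R ι : Type*} [CommRing R] [Fintype ι] [DecidableEq ι]

theorem adjugate_eq_of_mulVec_one [IsDomain R] {A : Matrix ι ι R} (h : A.mulVec 1 = 0)
    (i i' j : ι) :
    A.adjugate i j = A.adjugate i' j := by
  rw [Matrix.adjugate_apply, Matrix.adjugate_apply, ← sub_eq_zero, sub_eq_add_neg, ← neg_one_mul,
    ← Matrix.det_updateRow_smul, ← Matrix.det_updateRow_add]
  refine Matrix.exists_mulVec_eq_zero_iff.1 ⟨1, fun h1 => one_ne_zero (congrFun h1 i), ?_⟩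
  ext k
  by_cases hk : k = j
  · subst hk
    simp [Matrix.mulVec, dotProduct, Finset.sum_add_distrib, Pi.single_apply]
  · have := congrFun h k
    simpa [Matrix.mulVec, dotProduct, Matrix.updateRow_ne hk] using this

theorem mul_adjugate_eq_of_vecMul [IsDomain R] {A : Matrix ι ι R} {u : ι → R}
    (h : Matrix.vecMul u A = 0) (i j j' : ι) (hu : u j ≠ 0) : u j' * A.adjugate i j = u j * A.adjugate i j' := by
  have hadj (k : ι) : A.adjugate i k = (A.updateCol i (Pi.single k 1)).det := by
    change A.adjugate.transpose k i = _
    rw [Matrix.adjugate_transpose, Matrix.adjugate_apply, Matrix.updateRow_transpose,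
      Matrix.det_transpose]
  rw [hadj, hadj, ← sub_eq_zero, sub_eq_add_neg, ← neg_mul, ← Matrix.det_updateCol_smul,
    ← Matrix.det_updateCol_smul, ← Matrix.det_updateCol_add]
  refine Matrix.exists_vecMul_eq_zero_iff.1 ⟨u, fun h1 => hu (congrFun h1 j), ?_⟩
  ext k
  by_cases hk : k = i
  · subst hk
    simp [Matrix.vecMul, dotProduct, mul_add, Finset.sum_add_distrib, Pi.single_apply]
    ring
  · have := congrFun h k
    simpa [Matrix.vecMul, dotProduct, Matrix.updateCol_ne hk] using this

theorem exists_eq_succAbove_comp {k : ℕ} {f : Fin k → Fin (k + 1)} (hf : Function.Injective f) :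
    ∃ (i : Fin (k + 1)) (π : Equiv.Perm (Fin k)), f = i.succAbove ∘ π := by
  have : ¬ Function.Surjective f := fun h => by
    have := Fintype.card_le_of_surjective f h
    simp at this
  obtain ⟨i, hi⟩ : ∃ i, ∀ a, f a ≠ i := by simpa [Function.Surjective] using this
  choose π hπ using fun a => Fin.exists_succAbove_eq (hi a)
  have hinj : Function.Injective π := fun a b h => hf (by rw [← hπ, ← hπ, h])
  exact ⟨i, Equiv.ofBijective π (Finite.injective_iff_bijective.1 hinj),
    funext fun a => (hπ a).symm⟩

/-- If all cofactors of a square matrix are associated, then each of them is a greatest common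
divisor of the minors of corank one. -/
theorem dvd_minors_iff {k : ℕ} {A : Matrix (Fin (k + 1)) (Fin (k + 1)) R} {d : R}
    (h : ∀ i j, Associated (A.adjugate i j) d) (q : R) :
    (∀ (r c : Fin k → Fin (k + 1)), q ∣ (A.submatrix r c).det) ↔ q ∣ d := by
  constructor
  · intro h1
    rw [← (h 0 0).dvd_iff_dvd_right, Matrix.adjugate_fin_succ_eq_det_submatrix]
    exact (h1 _ _).mul_left _
  · intro h1 r c
    by_cases hr : Function.Injective r
    swap
    · obtain ⟨a, b, hab, hne⟩ : ∃ a b, r a = r b ∧ a ≠ b := by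
        simpa [Function.Injective] using hr
      rw [Matrix.det_zero_of_row_eq hne (by ext; simp [hab])]
      exact dvd_zero _
    by_cases hc : Function.Injective c
    swap
    · obtain ⟨a, b, hab, hne⟩ : ∃ a b, c a = c b ∧ a ≠ b := by
        simpa [Function.Injective] using hc
      rw [Matrix.det_zero_of_column_eq hne (by simp [hab])]
      exact dvd_zero _
    obtain ⟨i, π, rfl⟩ := exists_eq_succAbove_comp hr
    obtain ⟨j, ρ, rfl⟩ := exists_eq_succAbove_comp hc
    have e : A.submatrix (i.succAbove ∘ π) (j.succAbove ∘ ρ) =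
        ((A.submatrix i.succAbove j.succAbove).submatrix π id).submatrix id ρ := rfl
    rw [e, Matrix.det_permute', Matrix.det_permute]
    have := (h j i).dvd_iff_dvd_right.2 h1
    rw [Matrix.adjugate_fin_succ_eq_det_submatrix,
      (isUnit_one.neg.pow _).dvd_mul_left] at this
    exact (this.mul_left _).mul_left _

end Cofactors

/-! ### The Alexander polynomial of an alternating diagram -/

/-- The Laurent polynomials whose coefficients become nonnegative when `-t` is substituted
for `t`, as the semiring of the polynomials in `-t` with natural coefficients. -/
def alternatingCone : Subsemiring ℤ[T;T⁻¹] := Subsemiring.closure {-LaurentPolynomial.T 1}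

theorem coeff_nonneg_of_mem_alternatingCone {x : ℤ[T;T⁻¹]} (hx : x ∈ alternatingCone) (n : ℤ) :
    0 ≤ (n.negOnePow : ℤ) * x.coeff n := by
  rw [alternatingCone, Subsemiring.mem_closure_iff] at hx
  induction hx using AddSubmonoid.closure_induction with
  | mem x hx =>
    obtain ⟨k, rfl⟩ := Submonoid.mem_closure_singleton.1 hx
    have : (-LaurentPolynomial.T 1 : ℤ[T;T⁻¹]) ^ k =
        AddMonoidAlgebra.single (k : ℤ) ((-1) ^ k) := by
      rw [neg_pow, LaurentPolynomial.T_pow, mul_one, LaurentPolynomial.single_eq_C_mul_T]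
      simp
    rw [this, AddMonoidAlgebra.coeff_single, Finsupp.single_apply]
    split_ifs with h
    · subst h
      rw [Int.negOnePow_def]
      simp [← mul_pow]
    · simp
  | zero => simp
  | add x y _ _ hx hy =>
    rw [AddMonoidAlgebra.coeff_add, Finsupp.add_apply, mul_add]
    exact add_nonneg hx hy

namespace GaussDiagram

variable {D : GaussDiagram}

variable (D) in
/-- The columns of the Alexander matrix that belong to the edges. -/
def edgeMatrix : Matrix D.Passage D.Passage ℤ[T;T⁻¹] := D.alexanderMatrix.submatrix id Sum.inl

theorem edgeMatrix_mulVec_one : D.edgeMatrix.mulVec 1 = 0 := by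
  have h : D.IsColoring ℤ[T;T⁻¹] (Sum.elim (fun _ => 1) fun _ => 0) := by
    intro p
    simp only [PassageRel, Sum.elim_inl]
    split_ifs <;> simp
  have := (D.isSolution_alexanderMatrix_iff _ _).2 h
  ext p : 1
  have := this p
  rw [Fintype.sum_sum_type] at this
  simpa [Matrix.mulVec, dotProduct, edgeMatrix] using this

theorem edgeMatrix_vecMul {u : D.Passage → ℤ[T;T⁻¹]}
    (h : Matrix.vecMul u D.alexanderMatrix = 0) : Matrix.vecMul u D.edgeMatrix = 0 := by
  ext p : 1
  exact congrFun h (Sum.inl p)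

theorem edgeMatrix_over (x : Fin D.numCrossings) : D.edgeMatrix (x, true) =
    Pi.single (x, true) 1 - Pi.single (D.next.symm (x, true)) 1 := by
  ext q : 1
  simp [edgeMatrix, alexanderMatrix, outEdge, inEdge, Pi.single_apply]

theorem edgeMatrix_under_pos {x : Fin D.numCrossings} (h : D.sign x = 1) :
    D.edgeMatrix (x, false) = (1 - LaurentPolynomial.T 1 : ℤ[T;T⁻¹]) • Pi.single (x, true) 1 +
      (LaurentPolynomial.T 1 : ℤ[T;T⁻¹]) • Pi.single (D.next.symm (x, false)) 1 -
        Pi.single (x, false) 1 := by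
  ext q : 1
  simp [edgeMatrix, alexanderMatrix, outEdge, inEdge, Pi.single_apply, h]

theorem edgeMatrix_under_neg {x : Fin D.numCrossings} (h : D.sign x = -1) :
    D.edgeMatrix (x, false) = (1 - LaurentPolynomial.T 1 : ℤ[T;T⁻¹]) • Pi.single (x, true) 1 +
      (LaurentPolynomial.T 1 : ℤ[T;T⁻¹]) • Pi.single (x, false) 1 -
        Pi.single (D.next.symm (x, false)) 1 := by
  ext q : 1
  simp [edgeMatrix, alexanderMatrix, outEdge, inEdge, Pi.single_apply, h]

/-- In an alternating diagram every edge either leaves an over-passage, and belongs to the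
under-passage at the same crossing, or leads to an over-passage, to which it belongs. -/
theorem IsAlternating.exists_perm (h : D.IsAlternating) : ∃ σ : Equiv.Perm D.Passage,
    (∀ x, σ (x, true) = (x, false)) ∧ ∀ x, σ (x, false) = D.next (x, false) := by
  let σ : D.Passage → D.Passage := fun p => if p.2 then (p.1, false) else D.next p
  have hσ : Function.Injective σ := by
    rintro ⟨x, b⟩ ⟨y, b'⟩ hp
    have h1 := h (x, false)
    have h2 := h (y, false)
    cases b <;> cases b' <;> simp [σ] at hp
    · simpa using hp
    · rw [hp] at h1; simp at h1
    · rw [← hp] at h2; simp at h2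
    · simp [hp]
  exact ⟨Equiv.ofBijective σ (Finite.injective_iff_bijective.1 hσ), fun x => rfl, fun x => rfl⟩

/-- After a permutation of its rows and changes of sign, the Alexander matrix of an alternating
diagram at `-t` is the Laplacian of a directed graph on the edges with weights `1` and `t`. -/
theorem IsAlternating.exists_cofactor_mem (h : D.IsAlternating) (o : D.Passage) :
    ∃ o' : D.Passage, ∃ d ∈ alternatingCone, Associated (D.edgeMatrix.adjugate o o') d := by
  obtain ⟨σ, hσt, hσf⟩ := h.exists_perm
  let s : D.Passage → ℤ[T;T⁻¹] := fun p => if p = o then 1 else if p.2 then 1 else -1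
  let B := D.edgeMatrix.updateRow (σ o) (Pi.single o 1)
  let L : Matrix D.Passage D.Passage ℤ[T;T⁻¹] :=
    Matrix.of fun p q => s p * B.submatrix σ id p q
  have hdet : Associated L.det (D.edgeMatrix.adjugate o (σ o)) := by
    have hs (p : D.Passage) : IsUnit (s p) := by
      simp only [s]
      split_ifs
      exacts [isUnit_one, isUnit_one, isUnit_one.neg]
    have hsgn : IsUnit ((Equiv.Perm.sign σ : ℤ) : ℤ[T;T⁻¹]) :=
      (Equiv.Perm.sign σ).isUnit.map (Int.castRingHom ℤ[T;T⁻¹])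
    rw [Matrix.det_mul_column, Matrix.det_permute, Matrix.adjugate_apply, ← mul_assoc]
    refine associated_unit_mul_left _ _ (IsUnit.mul ?_ hsgn)
    exact IsUnit.prod_univ_iff.2 hs
  refine ⟨σ o, L.det, ?_, hdet.symm⟩
  let t : ℤ[T;T⁻¹] := LaurentPolynomial.T 1
  let w : D.Passage → Bool → ℤ[T;T⁻¹] := fun p k =>
    if k then 1 else if p.2 = true ∧ p ≠ o then -t else 0
  let f : D.Passage → Bool → Option D.Passage := fun p k =>
    if p = o then none
    else if p.2 then
      some (if k = decide (D.sign p.1 = 1) then (p.1, false) else D.next.symm (p.1, false))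
    else some (D.next p)
  refine det_laplacian_mem alternatingCone w (fun p k => ?_) f L fun p => ?_
  · simp only [w]
    split_ifs
    · exact one_mem _
    · exact Subsemiring.subset_closure rfl
    · exact zero_mem _
  · have e1 (p : D.Passage) : (fun q => if p = q then (1 : ℤ[T;T⁻¹]) else 0) = Pi.single p 1 := by
      ext q : 1
      simp [Pi.single_apply, eq_comm]
    have hL : L p = s p • B (σ p) := rfl
    have e2 (k : Bool) : (fun j => (if p = j then (1 : ℤ[T;T⁻¹]) else 0) -
        (if f p k = some j then 1 else 0)) =
        Pi.single p 1 - (f p k).elim 0 fun q => Pi.single q 1 := by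
      rw [← e1]
      cases hf : f p k with
      | none => ext q : 1; simp
      | some r =>
        ext q : 1
        simp [Pi.single_apply, eq_comm]
    rw [hL]
    simp only [e2, Fintype.sum_bool]
    by_cases hp : p = o
    · subst hp
      simp [s, B, w, f]
    · have hB : B (σ p) = D.edgeMatrix (σ p) :=
        Matrix.updateRow_ne fun h => hp (σ.injective h)
      rw [hB]
      obtain ⟨x, b⟩ := p
      cases b
      · have hnext : D.next (x, false) = ((D.next (x, false)).1, true) :=
            Prod.ext rfl (h (x, false))
        have := edgeMatrix_over (D.next (x, false)).1
        rw [← hnext, Equiv.symm_apply_apply] at this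
        rw [hσf, this]
        simp [s, w, f, hp]
      · rw [hσt]
        rcases Int.units_eq_one_or (D.sign x) with hx | hx
        · rw [edgeMatrix_under_pos hx]
          simp only [s, w, f, hp, hx, if_false, if_true, decide_true, Bool.false_eq_true,
            ne_eq, not_false_eq_true, and_self, Option.elim, t]
          module
        · rw [edgeMatrix_under_neg hx]
          have h1 : decide ((-1 : ℤˣ) = 1) = false := by decide
          simp only [s, w, f, hp, hx, if_false, if_true, h1, Bool.false_eq_true,
            ne_eq, not_false_eq_true, and_self, Option.elim, t]
          simp only [if_neg (show ¬ (true = false) by decide)]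
          module

theorem dvd_iff_of_isEmpty_circles [IsEmpty (Fin D.numCircles)] {d : ℤ[T;T⁻¹]}
    (hne : Nonempty D.Passage) (h : ∀ p q, Associated (D.edgeMatrix.adjugate p q) d)
    (q : ℤ[T;T⁻¹]) :
    (∀ (r : Fin (Fintype.card D.Gen - 1) → D.Passage) (c : Fin (Fintype.card D.Gen - 1) → D.Gen),
      q ∣ (D.alexanderMatrix.submatrix r c).det) ↔ q ∣ d := by
  have hcard : Fintype.card D.Passage = Fintype.card D.Gen - 1 + 1 := by
    have h1 : Fintype.card D.Gen = Fintype.card D.Passage := by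
      rw [Fintype.card_sum, Fintype.card_eq_zero (α := Fin D.numCircles), add_zero]
    have := Fintype.card_pos (α := D.Passage)
    omega
  generalize Fintype.card D.Gen - 1 = k at hcard
  let e : D.Passage ≃ Fin (k + 1) := Fintype.equivFinOfCardEq hcard
  let e' : D.Gen ≃ Fin (k + 1) := (Equiv.sumEmpty _ _).trans e
  have hA : D.alexanderMatrix = (D.edgeMatrix.submatrix e.symm e.symm).submatrix e e' := by
    ext p g : 2
    rcases g with g | g
    · simp [e', edgeMatrix]
    · exact isEmptyElim g
  rw [← dvd_minors_iff (A := D.edgeMatrix.submatrix e.symm e.symm) (d := d) ?_ q]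
  · rw [hA]
    constructor
    · intro hq r c
      have := hq (e.symm ∘ r) (e'.symm ∘ c)
      rw [Matrix.submatrix_submatrix, ← Function.comp_assoc, ← Function.comp_assoc,
        Equiv.self_comp_symm, Equiv.self_comp_symm] at this
      exact this
    · intro hq r c
      exact hq (e ∘ r) (e' ∘ c)
  · intro i j
    rw [Matrix.adjugate_submatrix_equiv_self]
    exact h _ _

/-- The Alexander polynomial of an alternating diagram has coefficients of alternating signs. -/
theorem IsAlternating.exists_mem_alternatingCone (h : D.IsAlternating) (hD : D.IsPlanar)
    {Δ : ℤ[T;T⁻¹]} (hΔ : D.IsAlexanderPolynomial Δ) : ∃ d ∈ alternatingCone, Associated Δ d := by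
  have hassoc {d : ℤ[T;T⁻¹]} (hd : ∀ q, (∀ (r : Fin (Fintype.card D.Gen - 1) → D.Passage)
      (c : Fin (Fintype.card D.Gen - 1) → D.Gen),
        q ∣ (D.alexanderMatrix.submatrix r c).det) ↔ q ∣ d) : Associated Δ d :=
    associated_of_dvd_dvd ((hd Δ).1 ((hΔ Δ).1 dvd_rfl)) ((hΔ d).2 ((hd d).2 dvd_rfl))
  obtain ⟨u, hu, huM⟩ := hD.exists_vecMul_alexanderMatrix
  by_cases hsmall : Fintype.card D.Gen - 1 = 0
  · -- at most one generator: the empty minor is `1`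
    refine ⟨1, one_mem _, hassoc fun q => ?_⟩
    have : IsEmpty (Fin (Fintype.card D.Gen - 1)) := by rw [hsmall]; infer_instance
    simp only [Matrix.det_isEmpty]
    exact ⟨fun h => h isEmptyElim isEmptyElim, fun h _ _ => h⟩
  have hcard : Fintype.card D.Gen = Fintype.card D.Passage + D.numCircles := by
    rw [Fintype.card_sum, Fintype.card_fin]
  by_cases hc : D.numCircles = 0
  · have : IsEmpty (Fin D.numCircles) := by rw [hc]; infer_instance
    have hne : Nonempty D.Passage := Fintype.card_pos_iff.1 (by omega)
    obtain ⟨o⟩ := id hne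
    obtain ⟨o', d, hd, ho⟩ := h.exists_cofactor_mem o
    refine ⟨d, hd, hassoc (dvd_iff_of_isEmpty_circles hne fun p q => ?_)⟩
    rw [adjugate_eq_of_mulVec_one edgeMatrix_mulVec_one p o q]
    refine Associated.trans ?_ ho
    have := mul_adjugate_eq_of_vecMul (edgeMatrix_vecMul huM) o o' q (hu o').ne_zero
    have h1 := associated_unit_mul_right (D.edgeMatrix.adjugate o q) (u o') (hu o')
    have h2 := associated_unit_mul_right (D.edgeMatrix.adjugate o o') (u q) (hu q)
    exact h1.trans (this ▸ h2.symm)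
  · -- a circle besides other generators splits off: all rows are needed, and they are dependent
    refine ⟨0, zero_mem _, hassoc fun q => ?_⟩
    simp only [dvd_zero, iff_true]
    intro r c
    suffices h0 : (D.alexanderMatrix.submatrix r c).det = 0 by rw [h0]; exact dvd_zero _
    by_cases hr : Function.Injective r
    · have hr' : Function.Bijective r := by
        refine (Fintype.bijective_iff_injective_and_card r).2 ⟨hr, ?_⟩
        have := Fintype.card_le_of_injective r hr
        rw [Fintype.card_fin] at this ⊢
        omega
      refine Matrix.exists_vecMul_eq_zero_iff.1 ⟨u ∘ r, fun h => ?_, ?_⟩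
      · exact (hu _).ne_zero (congrFun h ⟨0, Nat.pos_of_ne_zero hsmall⟩)
      · ext j : 1
        have := congrFun huM (c j)
        rw [Matrix.vecMul, dotProduct, ← Equiv.sum_comp (Equiv.ofBijective r hr')] at this
        exact this
    · obtain ⟨a, b, hab, hne⟩ : ∃ a b, r a = r b ∧ a ≠ b := by
        simpa [Function.Injective] using hr
      exact Matrix.det_zero_of_row_eq hne (by ext; simp [hab])

end GaussDiagram

/-! ### Coefficients and units of Laurent polynomials -/

namespace LaurentPolynomial

theorem coeff_mul_T {R : Type*} [Semiring R] (f : R[T;T⁻¹]) (m n : ℤ) :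
    (f * T m).coeff n = f.coeff (n - m) := by
  rw [T, AddMonoidAlgebra.coeff_mul_single_apply, mul_one, sub_eq_add_neg]

theorem exists_eq_T_of_isUnit {u : ℤ[T;T⁻¹]} (hu : IsUnit u) :
    ∃ m : ℤ, u = T m ∨ u = -T m := by
  obtain ⟨v, hv⟩ := hu.exists_right_inv
  obtain ⟨k, f, hf⟩ := exists_T_pow u
  obtain ⟨l, g, hg⟩ := exists_T_pow v
  have h1 : f * g = Polynomial.X ^ (k + l) := by
    apply Polynomial.toLaurent_injective
    rw [map_mul, hf, hg, Polynomial.toLaurent_X_pow, mul_mul_mul_comm, hv, one_mul, ← T_add]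
    simp
  obtain ⟨i, -, w, hw⟩ := (dvd_prime_pow Polynomial.prime_X _).1 (Dvd.intro g h1)
  obtain ⟨r, hr, hr'⟩ := Polynomial.isUnit_iff.1 w⁻¹.isUnit
  have h2 : f = Polynomial.X ^ i * Polynomial.C r := by
    rw [hr', ← hw, Units.mul_inv_cancel_right]
  have h3 : u = C r * T (i - k) := by
    have : u = Polynomial.toLaurent f * T (-k) := by
      rw [hf, mul_T_assoc]; simp
    rw [this, h2, map_mul, Polynomial.toLaurent_X_pow, Polynomial.toLaurent_C, T_mul, mul_T_assoc]
    rfl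
  refine ⟨i - k, ?_⟩
  rcases Int.isUnit_iff.1 hr with rfl | rfl
  · left; simpa using h3
  · right; simpa using h3

theorem exists_coeff_eq_of_associated {f g : ℤ[T;T⁻¹]} (h : Associated f g) :
    ∃ (m : ℤ) (s : ℤˣ), ∀ n, g.coeff n = s * f.coeff (n - m) := by
  obtain ⟨u, rfl⟩ := h
  obtain ⟨m, hm | hm⟩ := exists_eq_T_of_isUnit u.isUnit
  · exact ⟨m, 1, fun n => by rw [hm, coeff_mul_T]; simp⟩
  · exact ⟨m, -1, fun n => by
      rw [hm, mul_neg, AddMonoidAlgebra.coeff_neg, Finsupp.neg_apply, coeff_mul_T]; simp⟩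

theorem coeff_toLaurent_natCast (P : ℤ[X]) (k : ℕ) :
    (Polynomial.toLaurent P).coeff (k : ℤ) = P.coeff k := by
  rw [coeff_toLaurent]
  exact Finsupp.mapDomain_apply Nat.castEmbedding.injective _ _

theorem coeff_toLaurent_of_neg (P : ℤ[X]) {n : ℤ} (hn : n < 0) :
    (Polynomial.toLaurent P).coeff n = 0 := by
  rw [coeff_toLaurent]
  refine Finsupp.mapDomain_of_notMem_range _ _ ?_
  rintro ⟨k, hk⟩
  change (k : ℤ) = n at hk
  omega

end LaurentPolynomial

/-! ### Alternating signs and log-concavity -/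

/-- Log-concavity and the absence of internal zeros do not depend on the indexing of a finite
sequence. -/
theorem logConcaveUpTo_iff {d : ℕ} {c : ℕ → ℤ} {a : ℤ → ℤ} (m : ℤ) (h0 : ∀ k, 0 ≤ c k)
    (hd : ∀ k, d < k → c k = 0) (ha : ∀ k : ℕ, a (k + m) = c k) (ha' : ∀ n < m, a n = 0) :
    LogConcaveUpTo d (fun k => (c k : ℝ)) ↔ IsLogConcaveSeq a ∧ HasNoInternalZeros a := by
  have hnat (n : ℤ) (hn : m ≤ n) : ∃ k : ℕ, n = k + m := ⟨(n - m).toNat, by omega⟩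
  constructor
  · intro h
    constructor
    · intro n
      by_cases h1 : n - 1 < m
      · rw [ha' _ h1, zero_mul]; positivity
      obtain ⟨k, hk⟩ := hnat (n - 1) (by omega)
      obtain rfl : n = (k + 1 : ℕ) + m := by push_cast; omega
      rw [hk, show ((k + 1 : ℕ) + m + 1 : ℤ) = (k + 2 : ℕ) + m by push_cast; ring, ha, ha, ha]
      by_cases h2 : k + 2 ≤ d
      · exact_mod_cast h.logConcave k h2
      · rw [hd (k + 2) (by omega), mul_zero]; positivity
    · intro i j k hij hjk hi hk
      have hi' : m ≤ i := not_lt.1 fun h => hi (ha' _ h)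
      obtain ⟨i, rfl⟩ := hnat i hi'
      obtain ⟨j, rfl⟩ := hnat j (by omega)
      obtain ⟨k, rfl⟩ := hnat k (by omega)
      rw [ha] at hi hk ⊢
      have hkd : k ≤ d := not_lt.1 fun h => hk (hd _ h)
      exact_mod_cast h.no_internal_zeros i j k (by omega) (by omega) hkd (by exact_mod_cast hi)
        (by exact_mod_cast hk)
  · rintro ⟨h1, h2⟩
    refine ⟨fun k _ => by exact_mod_cast h0 k, fun k _ => ?_, fun i j k hij hjk _ hi hk => ?_⟩
    · have := h1 ((k + 1 : ℕ) + m)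
      rw [show ((k + 1 : ℕ) + m - 1 : ℤ) = k + m by push_cast; ring,
        show ((k + 1 : ℕ) + m + 1 : ℤ) = (k + 2 : ℕ) + m by push_cast; ring, ha, ha, ha] at this
      exact_mod_cast this
    · have := h2 (i + m) (j + m) (k + m) (by omega) (by omega)
        (by rw [ha]; exact_mod_cast hi) (by rw [ha]; exact_mod_cast hk)
      rw [ha] at this
      exact_mod_cast this

theorem coeff_comp_neg_X (P : ℤ[X]) (k : ℕ) :
    (P.comp (-Polynomial.X)).coeff k = (-1) ^ k * P.coeff k := by
  induction P using Polynomial.induction_on' with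
  | add p q hp hq =>
    rw [Polynomial.add_comp, Polynomial.coeff_add, hp, hq, Polynomial.coeff_add, mul_add]
  | monomial n r =>
    rw [Polynomial.monomial_comp, neg_pow, Polynomial.coeff_monomial, ← mul_assoc,
      show (-1 : ℤ[X]) ^ n = Polynomial.C ((-1) ^ n) by simp, ← Polynomial.C_mul,
      Polynomial.coeff_C_mul_X_pow]
    by_cases h : k = n
    · subst h; simp [mul_comm]
    · rw [if_neg h, if_neg (Ne.symm h), mul_zero]

/-- A polynomial associated to one with coefficients of alternating signs has nonnegative
coefficients at `-t`, provided that the leading one is nonnegative. -/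
theorem coeff_comp_neg_X_nonneg {P : ℤ[X]} {d : ℤ[T;T⁻¹]} (hd : d ∈ alternatingCone)
    (h : Associated d (Polynomial.toLaurent P)) (hsign : 0 ≤ (P.comp (-Polynomial.X)).leadingCoeff)
    (k : ℕ) : 0 ≤ (P.comp (-Polynomial.X)).coeff k := by
  obtain ⟨m, s, hs⟩ := LaurentPolynomial.exists_coeff_eq_of_associated h
  set Q := P.comp (-Polynomial.X) with hQ
  obtain ⟨ε, hε⟩ : ∃ ε : ℤˣ, ∀ k : ℕ, 0 ≤ (ε : ℤ) * Q.coeff k := by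
    refine ⟨s * m.negOnePow, fun k => ?_⟩
    have h1 := coeff_nonneg_of_mem_alternatingCone hd (k - m)
    have h2 := hs k
    rw [LaurentPolynomial.coeff_toLaurent_natCast] at h2
    have h3 : ((k : ℤ).negOnePow : ℤ) = (-1) ^ k := by
      rw [Int.negOnePow_def]; simp
    rw [Int.negOnePow_sub, Units.val_mul, h3] at h1
    have hss : (s : ℤ) * s = 1 := by rw [← Units.val_mul, Int.units_mul_self, Units.val_one]
    rw [hQ, coeff_comp_neg_X, h2, Units.val_mul]
    calc (0 : ℤ) ≤ _ := h1
      _ = (s * s) * ((-1) ^ k * (m.negOnePow : ℤ) * d.coeff (k - m)) := by rw [hss, one_mul]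
      _ = _ := by ring
  rcases Int.units_eq_one_or ε with rfl | rfl
  · simpa using hε k
  · have h0 : Q.leadingCoeff = 0 := by
      have := hε Q.natDegree
      simp only [Units.val_neg, Units.val_one, neg_mul, one_mul, Polynomial.coeff_natDegree] at this
      omega
    rw [Polynomial.leadingCoeff_eq_zero.1 h0, Polynomial.coeff_zero]

end

theorem proposition1p9 (L : Link) (hL : L.IsAlternating)
    (Δ : LaurentPolynomial ℤ) (hΔ : L.IsAlexanderPolynomial Δ)
    (P : Polynomial ℤ) (hP : Associated (Polynomial.toLaurent P) Δ)
    (hsign : 0 ≤ (P.comp (-Polynomial.X)).leadingCoeff) :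
    (homogNeg P).IsDenormalizedLorentzian ↔
      IsLogConcaveSeq (fun i => |Δ.coeff i|) ∧ HasNoInternalZeros (fun i => |Δ.coeff i|) := by
  obtain ⟨D, hDL, hD⟩ := hL
  obtain ⟨D', hDL', hD'⟩ := hΔ
  have hΔD := (Link.isAlexanderPolynomial_of_mk_eq (hDL.trans hDL'.symm) Δ).2 hD'
  obtain ⟨d, hd, hΔd⟩ := hD.exists_mem_alternatingCone D.planar hΔD
  have hnn := coeff_comp_neg_X_nonneg hd (hP.trans hΔd).symm hsign
  obtain ⟨m, s, hs⟩ := LaurentPolynomial.exists_coeff_eq_of_associated hP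
  set Q := P.comp (-Polynomial.X) with hQ
  have hhom : homogNeg P =
      (Q.map (Int.castRingHom ℝ)).homogenize (Q.map (Int.castRingHom ℝ)).natDegree := rfl
  have habs (n : ℤ) : |Δ.coeff n| = |(Polynomial.toLaurent P).coeff (n - m)| := by
    rw [hs, abs_mul, Int.isUnit_iff_abs_eq.1 s.isUnit, one_mul]
  have hcoeff (k : ℕ) : |Δ.coeff (k + m)| = Q.coeff k := by
    rw [habs, add_sub_cancel_right, LaurentPolynomial.coeff_toLaurent_natCast,
      ← abs_of_nonneg (hnn k), hQ, coeff_comp_neg_X, abs_mul, abs_pow, abs_neg, abs_one, one_pow,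
      one_mul]
  have hlow (n : ℤ) (hn : n < m) : |Δ.coeff n| = 0 := by
    rw [habs, LaurentPolynomial.coeff_toLaurent_of_neg _ (by omega), abs_zero]
  by_cases hQ0 : Q = 0
  · rw [hhom, hQ0, Polynomial.map_zero, Polynomial.homogenize_zero]
    refine iff_of_true MvPolynomial.zero_isDenormalizedLorentzian ?_
    have h0 (n : ℤ) : |Δ.coeff n| = 0 := by
      rcases lt_or_ge n m with hn | hn
      · exact hlow n hn
      · obtain ⟨k, rfl⟩ : ∃ k : ℕ, n = k + m := ⟨(n - m).toNat, by omega⟩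
        rw [hcoeff, hQ0, Polynomial.coeff_zero]
    exact ⟨fun n => by simp [h0], fun i _ _ _ _ hi => absurd (h0 i) hi⟩
  · have hinj : Function.Injective (Int.castRingHom ℝ) := Int.cast_injective
    rw [hhom, MvPolynomial.isDenormalizedLorentzian_homogenize_iff
      ((Polynomial.map_ne_zero_iff hinj).2 hQ0), Polynomial.natDegree_map_eq_of_injective hinj]
    have hmap : (Q.map (Int.castRingHom ℝ)).coeff = fun k => (Q.coeff k : ℝ) := by
      ext k; simp
    rw [hmap]
    exact logConcaveUpTo_iff m hnn (fun k hk => Polynomial.coeff_eq_zero_of_natDegree_lt hk)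
      hcoeff hlow
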